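/- Let $\zeta$ be the Riemann zeta function, $\mu$ the Möbius function, $(z)_n=\prod_{0\le k\le n-1}(z+k)$ the Pochhammer symbol, and $\xi(s)=\tfrac12 s(s-1)\pi^{-s/2}\Gamma(s/2)\zeta(s)$ the (entire) Riemann xi function. For $\beta\in\mathbb C$ with $\operatorname{Re}\beta\ge 0$ and integers $w\ge 0$ put $$f(s,\beta)=\frac{1}{\sin(\pi s/4)\cdot 2\xi(2\beta+s)},$$ $$P_{4w}(z,\beta)=\frac{(-1)^{w+1}}{\pi^{1-\beta}\Gamma(1+\beta)}\sum_{k\ge w+1}\frac{(-1)^k z^{2k}}{(1+\beta)_{2k}\,(2k+\beta-\frac12)\,\zeta(2\beta+4k)},$$ $$T_0(z,\beta,4w)=\frac{(-1)^{w+1}}{\pi^{1-\beta}\Gamma(1+\beta)}\sum_{k\ge w+1}\frac{(\pi z)^{2k}}{(1+\beta)_{2k}\,(2k+\beta-\frac12)}.$$ **A.** Fix $\beta$ with $\operatorname{Re}\beta\ge 0$ and set $m=\max\{0,1-2\operatorname{Re}\beta\}$. For every $w\ge0$ both series above converge absolutely for all $z\in\mathbb C$, and $P_{4w}(\cdot,\beta)$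 is entire. Moreover: 1. If $m<\operatorname{Re}s<4$, then $f(s,\beta)=\int_0^\infty v^{s-1}P_0(\pi v^{-2},\beta)\,dv$, with absolute convergence. 2. If $w\ge1$ and $4w<\operatorname{Re}s<4(w+1)$, then $(-1)^w f(s,\beta)=\int_0^\infty v^{s-1}P_{4w}(\pi v^{-2},\beta)\,dv$, with absolute convergence. 3. For all $w\ge0$ and $z\in\mathbb C$, $P_{4w}(\pi z,\beta)=\sum_{n\ge1}\mu(n)\,n^{-2\beta}\,T_0(iz/n^2,\beta,4w)$, with absolute convergence. 4. As $r\to+\infty$, $P_0(r,\beta)=O(r^{m/2})$, and $P_{4w}(r,\beta)=O(r^{2w})$ for every $w\ge1$ (the implied constants may depend on $\beta$ and $w$). **B.** Let $\beta=\tfrac14$ and write $f(s)=f(s,\tfrac14)$, $P_{4w}(z)=P_{4w}(z,\tfrac14)$, $\tilde c(4k)=1/\big(\pi^{3/4}\,\Gamma(\tfrac54+2k)\,(2k-\tfrac14)\,\zeta(\tfrac12+4k)\big)$. 1. On the strip $\tfrac12<\operatorname{Re}s<4$, $f$ is analytic and $f(s)=\int_{\mathbb R}e^{sy}P_0(\pi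 e^{-2y})\,dy$, with absolute convergence, where for all $z\in\mathbb C$ $$P_0(z)=-\frac{4}{\pi^{3/4}\Gamma(1/4)}\sum_{k\ge1}\frac{(-z^2)^k}{(5/4)_{2k}(2k-\frac14)\zeta(\frac12+4k)}=-\sum_{k\ge1}\tilde c(4k)(-z^2)^k .$$ 2. For $w\ge1$, on the strip $4w<\operatorname{Re}s<4(w+1)$, $f$ is analytic and $(-1)^wf(s)=\int_{\mathbb R}e^{sy}P_{4w}(\pi e^{-2y})\,dy$, with absolute convergence, where for all $z\in\mathbb C$ $$P_{4w}(z)=(-1)^w\Big(P_0(z)+\sum_{1\le k\le w}\tilde c(4k)(-z^2)^k\Big)=(-1)^{w+1}\sum_{k\ge w+1}\tilde c(4k)(-z^2)^k .$$ 3. For every $\varepsilon>0$, $P_0(v)=O(v^{1/4+\varepsilon})$ as $v\to+\infty$. -/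

import Mathlib

namespace XiMellin

open Complex

/-- The Riemann `ξ`-function `ξ(s) = (1/2) s (s - 1) π^(-s/2) Γ(s/2) ζ(s)`, written as an entire
function: `completedRiemannZeta₀ s = π^(-s/2) Γ(s/2) ζ(s) + 1/s + 1/(1-s)` is entire. -/
noncomputable def xi (s : ℂ) : ℂ :=
  (1 / 2) * (s * (s - 1) * completedRiemannZeta₀ s + 1)

/-- `xi` agrees with the product formula wherever the latter has no removable singularity
in the right half plane. -/
theorem xi_eq (s : ℂ) (hs : 0 < s.re) (hs1 : s ≠ 1) :
    xi s = (1 / 2) * ((Real.pi : ℂ) ^ (-s / 2) * (2 * Gamma (1 + s / 2)) * (s - 1))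
      * riemannZeta s := by
  have h0 : s ≠ 0 := by
    rintro rfl
    simp at hs
  have h1 : (1 : ℂ) - s ≠ 0 := sub_ne_zero.mpr (Ne.symm hs1)
  have hG : Gammaℝ s ≠ 0 := Gammaℝ_ne_zero_of_re_pos hs
  have hz : Gammaℝ s * riemannZeta s = completedRiemannZeta s := by
    rw [riemannZeta_def_of_ne_zero h0]
    field_simp
  have hg : Gamma (1 + s / 2) = s / 2 * Gamma (s / 2) := by
    rw [add_comm, Gamma_add_one _ (div_ne_zero h0 two_ne_zero)]
  have e : (1 / 2) * ((Real.pi : ℂ) ^ (-s / 2) * (2 * Gamma (1 + s / 2)) * (s - 1))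
      * riemannZeta s = (1 / 2) * s * (s - 1) * (Gammaℝ s * riemannZeta s) := by
    rw [hg, Gammaℝ_def]
    ring
  rw [e, hz, completedRiemannZeta_eq, xi]
  field_simp
  ring

/-- `f(s, β) = 1 / (sin(π s / 4) · 2 ξ(2β + s))`. -/
noncomputable def f (s β : ℂ) : ℂ :=
  1 / (sin (Real.pi * s / 4) * (2 * xi (2 * β + s)))

/-- The Pochhammer symbol `(z)_n = z (z + 1) ⋯ (z + n - 1)`. -/
noncomputable def poch (z : ℂ) (n : ℕ) : ℂ := (ascPochhammer ℂ n).eval z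

/-- The `k`-th term of the series for `P_{4w}(z, β)`. -/
noncomputable def PTerm (z β : ℂ) (k : ℕ) : ℂ :=
  (-1) ^ k * z ^ (2 * k) /
    (poch (1 + β) (2 * k) * (2 * k + β - 1 / 2) * riemannZeta (2 * β + 4 * k))

/-- `P w z β` is `P_{4w}(z, β)`; the sum is over `k = j + (w + 1)` with `j ≥ 0`,
that is, over `k ≥ w + 1`. -/
noncomputable def P (w : ℕ) (z β : ℂ) : ℂ :=
  ((-1) ^ (w + 1) / ((Real.pi : ℂ) ^ (1 - β) * Gamma (1 + β))) *
    ∑' j : ℕ, PTerm z β (j + (w + 1))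

/-- The `k`-th term of the series for `T_0(z, β, 4w)`. -/
noncomputable def TTerm (z β : ℂ) (k : ℕ) : ℂ :=
  (Real.pi * z) ^ (2 * k) / (poch (1 + β) (2 * k) * (2 * k + β - 1 / 2))

/-- `T0 z β w` is `T_0(z, β, 4w)`; the sum is over `k ≥ w + 1`. -/
noncomputable def T0 (z β : ℂ) (w : ℕ) : ℂ :=
  ((-1) ^ (w + 1) / ((Real.pi : ℂ) ^ (1 - β) * Gamma (1 + β))) *
    ∑' j : ℕ, TTerm z β (j + (w + 1))

/-- `cTilde k = 1 / (π^(3/4) Γ(5/4 + 2k) (2k - 1/4) ζ(1/2 + 4k))`, the coefficients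
for `β = 1/4`. -/
noncomputable def cTilde (k : ℕ) : ℂ :=
  1 / ((Real.pi : ℂ) ^ (3 / 4 : ℂ) * Gamma (5 / 4 + 2 * k) * (2 * k - 1 / 4) *
    riemannZeta (1 / 2 + 4 * k))

end XiMellin

namespace XiMellin

open Complex Filter Topology Set MeasureTheory

/-! ### Pochhammer symbols -/

/-! Integral formulas. Since 1/ζ(2β+4k) = ∑ μ(n) n^(-2β-4k), the zeta values can be removed from the
coefficients: P is a constant times ∑ μ(n) n^(-2β) `primTail` (z/n²). Likewise the factor
1/(2k+β-1/2) is ∫ t^(2k+β-3/2) dt over (0,1], so `primTail` is a multiplicative convolution of a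
power on (0,1] with `cosTail`. What remains is a tail of the even part of ₁F₁(1;1+β;iz), and its
Mellin transform comes from one more convolution: integrating it at xt against e^(-t) t^β cancels
the Pochhammer symbols and leaves Γ(1+β)(-x²)^(w+1)/(1+x²), whose Mellin transform is a reciprocal
sine. `hasMellin_mul_convolution` turns every convolution into a product, the sum over n supplies
1/ζ(2β+2q), and x = πv^(-2), q = s/2 gives f. Removing the terms k ≤ w moves the strip of
convergence to 4w < Re s < 4(w+1) and leaves the transform unchanged except for the sign carried by
the prefactor.

Two facts need the differential equation `mul_deriv_kummer`: t^β e^(-ct) ₁F₁(ct) has derivative β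
t^(β-1) e^(-ct), which bounds ₁F₁ on the imaginary axis, and the Laplace transform is found for
every x > 0, beyond the range where termwise integration converges.

Growth. Write r = x² and A = `primTail β 0`, so that P_0(x²) is a constant times ∑ μ(n) n^(-2β)
A((x/n)²). If Re β > 1/2, A is bounded and the sum converges absolutely. Otherwise cut at n = x.
Beyond the cut A is small. Below it A(Y²) = J Y^(1-2β) + remainder, and the first part contributes J
x^(1-2β) ∑ μ(n)/n, whose partial sums are bounded. For Re β < 1/2 the remainder is bounded and can
be summed trivially. On Re β = 1/2 that would lose a logarithm; there the remainder is -2∫_1^Y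
u^(-2β) du + O(1/Y), and its Möbius sum is bounded by comparing ∑_{m ≤ y} m^(-s) with an integral in
the identity μ * 1 = δ twisted by n^(-s), using ζ(1+it) ≠ 0
(`exists_norm_sum_moebiusPow_mul_integral_le`). -/

theorem poch_zero (z : ℂ) : poch z 0 = 1 := by simp [poch]

theorem poch_succ (z : ℂ) (n : ℕ) : poch z (n + 1) = poch z n * (z + n) := by
  simp [poch, ascPochhammer_succ_right]

/-- The factor 1 + β + k has real part at least k + 1. All series over k are thereby compared with
the exponential series. -/
theorem factorial_le_norm_poch {β : ℂ} (hβ : 0 ≤ β.re) (n : ℕ) :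
    (n.factorial : ℝ) ≤ ‖poch (1 + β) n‖ := by
  induction n with
  | zero => simp [poch_zero]
  | succ n ih =>
    rw [poch_succ, norm_mul, Nat.factorial_succ, Nat.cast_mul, mul_comm]
    refine mul_le_mul ih ?_ (by positivity) (norm_nonneg _)
    refine le_trans ?_ (re_le_norm _)
    simp
    linarith

theorem poch_ne_zero {β : ℂ} (hβ : 0 ≤ β.re) (n : ℕ) : poch (1 + β) n ≠ 0 := by
  have h := factorial_le_norm_poch hβ n
  have : (0 : ℝ) < n.factorial := by positivity
  exact norm_pos_iff.mp (this.trans_le h)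

theorem Gamma_one_add_ne_zero {β : ℂ} (hβ : 0 ≤ β.re) : Gamma (1 + β) ≠ 0 :=
  Gamma_ne_zero_of_re_pos (by simp; linarith)

theorem Gamma_one_add_add_nat {β : ℂ} (hβ : 0 ≤ β.re) (n : ℕ) :
    Gamma (1 + β + n) = Gamma (1 + β) * poch (1 + β) n := by
  have h := Gamma_add_nat_div_Gamma_eq (n := n) (1 + β) (fun k hk => by
    have := congrArg re hk
    simp at this
    have hk0 : (0 : ℝ) ≤ k := k.cast_nonneg
    linarith)
  rw [poch, ← h, mul_div_cancel₀ _ (Gamma_one_add_ne_zero hβ)]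

theorem norm_pow_div_poch_le {β : ℂ} (hβ : 0 ≤ β.re) (z : ℂ) (n : ℕ) :
    ‖z ^ n / poch (1 + β) n‖ ≤ ‖z‖ ^ n / n.factorial := by
  rw [norm_div, norm_pow]
  gcongr
  exact factorial_le_norm_poch hβ n

/-! ### The confluent hypergeometric function `₁F₁(1; 1 + β; z)` -/

/-- The confluent hypergeometric function `₁F₁(1; 1 + β; z) = ∑ zⁿ / (1 + β)ₙ`. -/
noncomputable def kummer (β z : ℂ) : ℂ := ∑' n : ℕ, z ^ n / poch (1 + β) n

theorem summable_norm_kummer {β : ℂ} (hβ : 0 ≤ β.re) (z : ℂ) :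
    Summable fun n : ℕ => ‖z ^ n / poch (1 + β) n‖ :=
  .of_nonneg_of_le (fun _ => norm_nonneg _) (norm_pow_div_poch_le hβ z)
    (Real.summable_pow_div_factorial ‖z‖)

theorem hasSum_kummer {β : ℂ} (hβ : 0 ≤ β.re) (z : ℂ) :
    HasSum (fun n : ℕ => z ^ n / poch (1 + β) n) (kummer β z) :=
  (summable_norm_kummer hβ z).of_norm.hasSum

theorem differentiable_kummer {β : ℂ} (hβ : 0 ≤ β.re) : Differentiable ℂ (kummer β) := by
  intro z
  have h : DifferentiableOn ℂ (kummer β) (Metric.ball 0 (‖z‖ + 1)) := by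
    refine differentiableOn_tsum_of_summable_norm
      (Real.summable_pow_div_factorial (‖z‖ + 1)) (fun n => by fun_prop) Metric.isOpen_ball ?_
    intro n w hw
    refine (norm_pow_div_poch_le hβ w n).trans ?_
    gcongr
    simpa using (Metric.mem_ball.mp hw).le
  exact h.differentiableAt (Metric.isOpen_ball.mem_nhds (by simp))

/-- The differential equation of `₁F₁(1; 1 + β; z)`. -/
theorem mul_deriv_kummer {β : ℂ} (hβ : 0 ≤ β.re) (z : ℂ) :
    z * deriv (kummer β) z = (z - β) * kummer β z + β := by
  have hd : HasSum (fun n : ℕ => deriv (fun w : ℂ => w ^ n / poch (1 + β) n) z)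
      (deriv (kummer β) z) := by
    refine hasSum_deriv_of_summable_norm (U := Metric.ball 0 (‖z‖ + 1))
      (Real.summable_pow_div_factorial (‖z‖ + 1)) (fun n => by fun_prop) Metric.isOpen_ball ?_
      (by simp)
    intro n w hw
    refine (norm_pow_div_poch_le hβ w n).trans ?_
    gcongr
    simpa using (Metric.mem_ball.mp hw).le
  have h1 : HasSum (fun n : ℕ => (n + β) * (z ^ n / poch (1 + β) n))
      (z * deriv (kummer β) z + β * kummer β z) := by
    refine ((hd.mul_left z).add ((hasSum_kummer hβ z).mul_left β)).congr_fun ?_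
    intro n
    simp only [deriv_div_const, deriv_pow_field]
    rcases n with _ | n
    · simp
    · simp
      ring
  -- The weight n + 1 + β is exactly the last factor of (1 + β)_{n+1}, so weighting by n + β shifts
  -- the series by one place.
  have h2 : HasSum (fun n : ℕ => ((n + 1 : ℕ) + β) * (z ^ (n + 1) / poch (1 + β) (n + 1)))
      (z * kummer β z) := by
    refine ((hasSum_kummer hβ z).mul_left z).congr_fun ?_
    intro n
    have h3 := poch_ne_zero hβ (n + 1)
    rw [poch_succ] at h3 ⊢
    have h4 := right_ne_zero_of_mul h3
    have h5 := left_ne_zero_of_mul h3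
    push_cast
    field_simp
    ring
  have h3 := (hasSum_nat_add_iff' 1).mpr h1
  have h4 := h3.unique h2
  simp [poch_zero] at h4
  linear_combination h4

theorem hasDerivAt_kummer {β : ℂ} (hβ : 0 ≤ β.re) (z : ℂ) :
    HasDerivAt (kummer β) (deriv (kummer β) z) z :=
  (differentiable_kummer hβ z).hasDerivAt

theorem kummer_zero {β : ℂ} (hβ : 0 ≤ β.re) : kummer β 0 = 1 := by
  refine (hasSum_kummer hβ 0).unique ?_
  convert! hasSum_single (f := fun n : ℕ => (0 : ℂ) ^ n / poch (1 + β) n) 0 ?_ using 1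
  · simp [poch_zero]
  · intro n hn
    simp [hn]

/-! ### The even part of `₁F₁(1; 1 + β; iz)` -/

/-- The `k`-th term of the even part of `₁F₁(1; 1 + β; iz)`. -/
noncomputable def cosTerm (β z : ℂ) (k : ℕ) : ℂ := (-1) ^ k * z ^ (2 * k) / poch (1 + β) (2 * k)

/-- The even part of `₁F₁(1; 1 + β; iz)`; for `β = 0` this is `cos z`. -/
noncomputable def cosSeries (β z : ℂ) : ℂ := (kummer β (I * z) + kummer β (-I * z)) / 2

theorem norm_cosTerm_le {β : ℂ} (hβ : 0 ≤ β.re) (z : ℂ) (k : ℕ) :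
    ‖cosTerm β z k‖ ≤ ‖z‖ ^ (2 * k) / (2 * k).factorial := by
  have h := norm_pow_div_poch_le hβ z (2 * k)
  rwa [cosTerm, mul_div_assoc, norm_mul, norm_pow, norm_neg, norm_one, one_pow, one_mul]

theorem summable_pow_two_mul_div_factorial (x : ℝ) :
    Summable fun k : ℕ => x ^ (2 * k) / (2 * k).factorial :=
  (Real.summable_pow_div_factorial x).comp_injective
    (fun a b h => by simpa using h : Function.Injective fun k : ℕ => 2 * k)

theorem summable_norm_cosTerm {β : ℂ} (hβ : 0 ≤ β.re) (z : ℂ) :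
    Summable fun k : ℕ => ‖cosTerm β z k‖ :=
  .of_nonneg_of_le (fun _ => norm_nonneg _) (norm_cosTerm_le hβ z)
    (summable_pow_two_mul_div_factorial _)

theorem hasSum_cosTerm {β : ℂ} (hβ : 0 ≤ β.re) (z : ℂ) :
    HasSum (cosTerm β z) (cosSeries β z) := by
  have h := ((hasSum_kummer hβ (I * z)).add (hasSum_kummer hβ (-I * z))).div_const 2
  have hinj : Function.Injective fun k : ℕ => 2 * k := fun a b h => by simpa using h
  refine ((hinj.hasSum_iff ?_).mpr h).congr_fun ?_
  · intro n hn
    have : Odd n := by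
      rcases Nat.even_or_odd' n with ⟨k, rfl | rfl⟩
      · exact absurd ⟨k, rfl⟩ hn
      · exact ⟨k, rfl⟩
    rw [neg_mul, this.neg_pow]
    ring
  · intro k
    simp only [Function.comp, cosTerm, mul_pow, pow_mul, neg_sq, I_sq]
    ring

/-- The tail `∑_{k ≥ w + 1}` of the series for `cosSeries`. -/
noncomputable def cosTail (β : ℂ) (w : ℕ) (z : ℂ) : ℂ := ∑' j : ℕ, cosTerm β z (j + (w + 1))

theorem hasSum_cosTail {β : ℂ} (hβ : 0 ≤ β.re) (w : ℕ) (z : ℂ) :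
    HasSum (fun j => cosTerm β z (j + (w + 1))) (cosTail β w z) :=
  ((summable_nat_add_iff (w + 1)).mpr (summable_norm_cosTerm hβ z).of_norm).hasSum

theorem cosTail_eq {β : ℂ} (hβ : 0 ≤ β.re) (w : ℕ) (z : ℂ) :
    cosTail β w z = cosSeries β z - ∑ k ∈ Finset.range (w + 1), cosTerm β z k :=
  (hasSum_cosTail hβ w z).unique ((hasSum_nat_add_iff' (w + 1)).mpr (hasSum_cosTerm hβ z))

theorem differentiable_cosSeries {β : ℂ} (hβ : 0 ≤ β.re) : Differentiable ℂ (cosSeries β) := by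
  have h := differentiable_kummer hβ
  unfold cosSeries
  fun_prop

theorem differentiable_cosTail {β : ℂ} (hβ : 0 ≤ β.re) (w : ℕ) :
    Differentiable ℂ (cosTail β w) := by
  have h := differentiable_cosSeries hβ
  have : cosTail β w = fun z => cosSeries β z - ∑ k ∈ Finset.range (w + 1), cosTerm β z k :=
    funext (cosTail_eq hβ w)
  rw [this]
  unfold cosTerm
  fun_prop

/-- Near the origin `cosTail β w` is of order `2 (w + 1)`. -/
theorem norm_cosTail_le {β : ℂ} (hβ : 0 ≤ β.re) (w : ℕ) {z : ℂ} (hz : ‖z‖ ≤ 1) :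
    ‖cosTail β w z‖ ≤ Real.exp 1 * ‖z‖ ^ (2 * (w + 1)) := by
  have hs : Summable fun j : ℕ =>
      ‖z‖ ^ (2 * (w + 1)) * (1 / ((2 * (j + (w + 1))).factorial : ℝ)) := by
    have h1 := (summable_nat_add_iff (w + 1)).mpr (summable_pow_two_mul_div_factorial 1)
    simp only [one_pow] at h1
    exact h1.mul_left _
  have h := tsum_of_norm_bounded hs.hasSum (f := fun j => cosTerm β z (j + (w + 1))) (fun j => by
    refine (norm_cosTerm_le hβ z _).trans ?_
    rw [mul_add, pow_add, mul_comm (_ ^ _), mul_div_assoc]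
    refine mul_le_mul_of_nonneg_left ?_ (by positivity)
    gcongr
    exact pow_le_one₀ (norm_nonneg _) hz)
  refine h.trans ?_
  rw [tsum_mul_left, mul_comm]
  refine mul_le_mul_of_nonneg_right ?_ (by positivity)
  have he : HasSum (fun n : ℕ => (1 : ℝ) / n.factorial) (Real.exp 1) := by
    simpa [Real.exp_eq_exp_ℝ] using NormedSpace.expSeries_div_hasSum_exp (1 : ℝ)
  rw [← he.tsum_eq]
  refine tsum_comp_le_tsum_of_inj he.summable (fun n => by positivity)
    (fun a b h => by simpa using h : Function.Injective fun j : ℕ => 2 * (j + (w + 1)))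

/-! ### The series weighted by `1 / (2k + β - 1/2)` -/

/-- The `k`-th term of the series `primTail`. -/
noncomputable def primTerm (β z : ℂ) (k : ℕ) : ℂ := cosTerm β z k / (2 * k + β - 1 / 2)

/-- The series `∑_{k ≥ w + 1} (-1)^k z^{2k} / ((1 + β)_{2k} (2k + β - 1/2))`. -/
noncomputable def primTail (β : ℂ) (w : ℕ) (z : ℂ) : ℂ := ∑' j : ℕ, primTerm β z (j + (w + 1))

/-- Only k ≥ 1 is safe: the factor for k = 0 is β - 1/2, which may vanish. -/
theorem one_le_norm_two_mul_add {β : ℂ} (hβ : 0 ≤ β.re) {k : ℕ} (hk : 1 ≤ k) :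
    1 ≤ ‖2 * (k : ℂ) + β - 1 / 2‖ := by
  refine le_trans ?_ (re_le_norm _)
  have : (1 : ℝ) ≤ k := by exact_mod_cast hk
  simp
  linarith

theorem norm_primTerm_le {β : ℂ} (hβ : 0 ≤ β.re) (z : ℂ) {k : ℕ} (hk : 1 ≤ k) :
    ‖primTerm β z k‖ ≤ ‖z‖ ^ (2 * k) / (2 * k).factorial := by
  rw [primTerm, norm_div]
  exact (div_le_self (norm_nonneg _) (one_le_norm_two_mul_add hβ hk)).trans
    (norm_cosTerm_le hβ z k)

theorem summable_tail_pow_div_factorial (w : ℕ) (x : ℝ) :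
    Summable fun j : ℕ => x ^ (2 * (j + (w + 1))) / (2 * (j + (w + 1))).factorial :=
  (summable_nat_add_iff (w + 1)).mpr (summable_pow_two_mul_div_factorial x)

theorem summable_norm_primTerm {β : ℂ} (hβ : 0 ≤ β.re) (w : ℕ) (z : ℂ) :
    Summable fun j : ℕ => ‖primTerm β z (j + (w + 1))‖ :=
  .of_nonneg_of_le (fun _ => norm_nonneg _) (fun j => norm_primTerm_le hβ z (by lia))
    (summable_tail_pow_div_factorial w _)

theorem PTerm_eq (β z : ℂ) (k : ℕ) :
    PTerm z β k = primTerm β z k * (riemannZeta (2 * β + 4 * k))⁻¹ := by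
  rw [PTerm, primTerm, cosTerm, div_div, ← div_eq_mul_inv, div_div]

theorem TTerm_eq (β z : ℂ) (n k : ℕ) :
    TTerm (I * z / (n : ℂ) ^ 2) β k = primTerm β (Real.pi * z / (n : ℂ) ^ 2) k := by
  rw [TTerm, primTerm, cosTerm, div_div]
  congr 1
  rw [pow_mul, pow_mul, ← mul_pow]
  congr 1
  rw [mul_div_assoc', div_pow, div_pow, mul_pow, mul_pow, mul_pow, I_sq]
  ring

/-! ### The reciprocal of the zeta function -/

theorem norm_moebius_le_one (n : ℕ) : ‖((ArithmeticFunction.moebius n : ℤ) : ℂ)‖ ≤ 1 := by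
  have h := ArithmeticFunction.abs_moebius_le_one (n := n)
  rw [norm_intCast]
  exact_mod_cast h

theorem norm_moebius_div_le (n : ℕ+) (s : ℂ) :
    ‖((ArithmeticFunction.moebius (n : ℕ) : ℤ) : ℂ) / ((n : ℕ) : ℂ) ^ s‖ ≤
      ((n : ℕ) : ℝ) ^ (-s.re) := by
  rw [norm_div, norm_natCast_cpow_of_pos n.pos, Real.rpow_neg (by positivity), ← one_div]
  gcongr
  exact norm_moebius_le_one _

theorem hasSum_inv_riemannZeta {s : ℂ} (hs : 1 < s.re) :
    HasSum (fun n : ℕ+ => ((ArithmeticFunction.moebius (n : ℕ) : ℤ) : ℂ) / ((n : ℕ) : ℂ) ^ s)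
      (riemannZeta s)⁻¹ := by
  have h1 := ArithmeticFunction.LSeriesSummable_moebius_iff.mpr hs
  have h2 := LSeries_one_mul_Lseries_moebius hs
  rw [LSeries_one_eq_riemannZeta hs] at h2
  have h3 := LSeriesSummable.LSeriesHasSum h1
  rw [eq_inv_of_mul_eq_one_right h2, LSeriesHasSum] at h3
  refine ((PNat.coe_injective.hasSum_iff ?_).mpr h3).congr_fun ?_
  · intro n hn
    have : n = 0 := by
      by_contra h0
      exact hn ⟨⟨n, Nat.pos_of_ne_zero h0⟩, rfl⟩
    simp [this]
  · intro n
    simp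

theorem summable_pnat_rpow {a : ℝ} (ha : 1 < a) :
    Summable fun n : ℕ+ => ((n : ℕ) : ℝ) ^ (-a) :=
  (Real.summable_nat_rpow.mpr (by linarith : -a < -1)).comp_injective PNat.coe_injective

/-- A bound uniform in s, so that the zeta factors do not affect the convergence in k. -/
theorem norm_inv_riemannZeta_le {s : ℂ} (hs : 2 ≤ s.re) :
    ‖(riemannZeta s)⁻¹‖ ≤ ∑' n : ℕ+, ((n : ℕ) : ℝ) ^ (-2 : ℝ) := by
  rw [← (hasSum_inv_riemannZeta (by linarith : 1 < s.re)).tsum_eq]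
  refine tsum_of_norm_bounded (summable_pnat_rpow (by norm_num)).hasSum fun n => ?_
  refine (norm_moebius_div_le n s).trans ?_
  exact Real.rpow_le_rpow_of_exponent_le (by exact_mod_cast n.pos) (by linarith)

theorem two_le_re_two_mul_add {β : ℂ} (hβ : 0 ≤ β.re) {k : ℕ} (hk : 1 ≤ k) :
    2 ≤ (2 * β + 4 * (k : ℂ)).re := by
  have : (1 : ℝ) ≤ k := by exact_mod_cast hk
  simp
  linarith

/-! ### Convergence and analyticity of `P` -/

theorem norm_PTerm_le {β : ℂ} (hβ : 0 ≤ β.re) (z : ℂ) {k : ℕ} (hk : 1 ≤ k) :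
    ‖PTerm z β k‖ ≤ ‖z‖ ^ (2 * k) / (2 * k).factorial * ∑' n : ℕ+, ((n : ℕ) : ℝ) ^ (-2 : ℝ) := by
  rw [PTerm_eq, norm_mul]
  exact mul_le_mul (norm_primTerm_le hβ z hk)
    (norm_inv_riemannZeta_le (two_le_re_two_mul_add hβ hk)) (norm_nonneg _) (by positivity)

theorem summable_norm_PTerm {β : ℂ} (hβ : 0 ≤ β.re) (w : ℕ) (z : ℂ) :
    Summable fun j : ℕ => ‖PTerm z β (j + (w + 1))‖ :=
  .of_nonneg_of_le (fun _ => norm_nonneg _) (fun j => norm_PTerm_le hβ z (by lia))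
    ((summable_tail_pow_div_factorial w _).mul_right _)

theorem summable_norm_TTerm {β : ℂ} (hβ : 0 ≤ β.re) (w : ℕ) (z : ℂ) :
    Summable fun j : ℕ => ‖TTerm z β (j + (w + 1))‖ := by
  -- The argument -I z undoes the factor I of `TTerm_eq`, taken at n = 1.
  have h := summable_norm_primTerm hβ w (Real.pi * (-I * z))
  have e (k : ℕ) : TTerm z β k = primTerm β (Real.pi * (-I * z)) k := by
    have := TTerm_eq β (-I * z) 1 k
    rwa [Nat.cast_one, one_pow, div_one, div_one, ← mul_assoc, mul_neg, I_mul_I, neg_neg,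
      one_mul] at this
  simpa only [e] using h

theorem differentiable_P {β : ℂ} (hβ : 0 ≤ β.re) (w : ℕ) :
    Differentiable ℂ fun z : ℂ => P w z β := by
  intro z
  refine DifferentiableAt.const_mul ?_ _
  have h : DifferentiableOn ℂ (fun z => ∑' j : ℕ, PTerm z β (j + (w + 1)))
      (Metric.ball 0 (‖z‖ + 1)) := by
    refine differentiableOn_tsum_of_summable_norm
      ((summable_tail_pow_div_factorial w (‖z‖ + 1)).mul_right
        (∑' n : ℕ+, ((n : ℕ) : ℝ) ^ (-2 : ℝ)))
      (fun n => by unfold PTerm; fun_prop) Metric.isOpen_ball ?_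
    intro n x hx
    refine (norm_PTerm_le hβ x (by lia)).trans ?_
    have : ‖x‖ ≤ ‖z‖ + 1 := by simpa using (Metric.mem_ball.mp hx).le
    have h0 : 0 ≤ ∑' n : ℕ+, ((n : ℕ) : ℝ) ^ (-2 : ℝ) := tsum_nonneg fun n => by positivity
    gcongr
  exact h.differentiableAt (Metric.isOpen_ball.mem_nhds (by simp))

/-! ### The Möbius expansion of `P` -/

/-- The constant in front of the series defining `P` and `T0`. -/
noncomputable def prefactor (β : ℂ) (w : ℕ) : ℂ :=
  (-1) ^ (w + 1) / ((Real.pi : ℂ) ^ (1 - β) * Gamma (1 + β))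

theorem T0_eq (β z : ℂ) (n w : ℕ) :
    T0 (I * z / (n : ℂ) ^ 2) β w =
      prefactor β w * primTail β w (Real.pi * z / (n : ℂ) ^ 2) := by
  simp only [T0, TTerm_eq, prefactor, primTail]

/-- The dependence of n^(-2β-4k) on k is that of the rescaling z ↦ z/n² in z^(2k). -/
theorem natCast_cpow_add_four_mul (n : ℕ+) (s : ℂ) (k : ℕ) :
    ((n : ℕ) : ℂ) ^ (s + 4 * k) = ((n : ℕ) : ℂ) ^ s * (((n : ℕ) : ℂ) ^ 2) ^ (2 * k) := by
  have h0 : ((n : ℕ) : ℂ) ≠ 0 := by exact_mod_cast n.ne_zero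
  rw [cpow_add _ _ h0, ← pow_mul, show (4 * k : ℂ) = ((2 * (2 * k) : ℕ) : ℂ) by push_cast; ring,
    cpow_natCast]

theorem primTerm_div (β z c : ℂ) (k : ℕ) :
    primTerm β (z / c) k = primTerm β z k / c ^ (2 * k) := by
  simp only [primTerm, cosTerm, div_pow]
  ring

/-- The weight n^(-2β) need not be summable, but k ≥ 1 adds n^(-4k); the double series is dominated
by ∑ n^(-2) times the series in k. -/
theorem summable_norm_moebius_mul_primTerm {β : ℂ} (hβ : 0 ≤ β.re) (w : ℕ) (z : ℂ) :
    Summable fun p : ℕ+ × ℕ => ‖((ArithmeticFunction.moebius (p.1 : ℕ) : ℤ) : ℂ) /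
      ((p.1 : ℕ) : ℂ) ^ (2 * β) * primTerm β (z / ((p.1 : ℕ) : ℂ) ^ 2) (p.2 + (w + 1))‖ := by
  refine .of_nonneg_of_le (fun _ => norm_nonneg _) (fun p => ?_)
    ((summable_pnat_rpow (by norm_num : (1 : ℝ) < 2)).mul_of_nonneg
      (summable_norm_primTerm hβ w z) (fun n => by positivity) (fun n => by positivity))
  rw [primTerm_div, div_mul_div_comm, ← natCast_cpow_add_four_mul, mul_div_right_comm, norm_mul]
  refine mul_le_mul_of_nonneg_right ((norm_moebius_div_le _ _).trans ?_) (norm_nonneg _)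
  exact Real.rpow_le_rpow_of_exponent_le (by exact_mod_cast p.1.pos)
    (by have := two_le_re_two_mul_add hβ (k := p.2 + (w + 1)) (by lia); linarith)

theorem summable_norm_moebius_mul_primTail {β : ℂ} (hβ : 0 ≤ β.re) (w : ℕ) (z : ℂ) :
    Summable fun n : ℕ+ => ‖((ArithmeticFunction.moebius (n : ℕ) : ℤ) : ℂ) /
      ((n : ℕ) : ℂ) ^ (2 * β) * primTail β w (z / ((n : ℕ) : ℂ) ^ 2)‖ := by
  refine .of_nonneg_of_le (fun _ => norm_nonneg _) (fun n => ?_)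
    (summable_norm_moebius_mul_primTerm hβ w z).prod
  rw [primTail, ← tsum_mul_left]
  exact norm_tsum_le_tsum_norm ((summable_norm_moebius_mul_primTerm hβ w z).prod_factor n)

theorem hasSum_moebius_mul_primTail {β : ℂ} (hβ : 0 ≤ β.re) (w : ℕ) (z : ℂ) :
    HasSum (fun n : ℕ+ => ((ArithmeticFunction.moebius (n : ℕ) : ℤ) : ℂ) /
      ((n : ℕ) : ℂ) ^ (2 * β) * primTail β w (z / ((n : ℕ) : ℂ) ^ 2))
      (∑' j : ℕ, PTerm z β (j + (w + 1))) := by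
  have hs := (summable_norm_moebius_mul_primTerm hβ w z).of_norm
  have hc := Summable.tsum_comm (f := fun (n : ℕ+) (j : ℕ) =>
    ((ArithmeticFunction.moebius (n : ℕ) : ℤ) : ℂ) / ((n : ℕ) : ℂ) ^ (2 * β) *
      primTerm β (z / ((n : ℕ) : ℂ) ^ 2) (j + (w + 1))) hs
  have h := (summable_norm_moebius_mul_primTail hβ w z).of_norm.hasSum
  have e : ∑' n : ℕ+, ((ArithmeticFunction.moebius (n : ℕ) : ℤ) : ℂ) /
      ((n : ℕ) : ℂ) ^ (2 * β) * primTail β w (z / ((n : ℕ) : ℂ) ^ 2) =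
      ∑' j : ℕ, PTerm z β (j + (w + 1)) := by
    simp only [primTail, ← tsum_mul_left]
    rw [← hc]
    refine tsum_congr fun j => ?_
    rw [PTerm_eq, ← (hasSum_inv_riemannZeta
      (lt_of_lt_of_le one_lt_two (two_le_re_two_mul_add hβ (by lia)))).tsum_eq, ← tsum_mul_left]
    refine tsum_congr fun n => ?_
    rw [primTerm_div, div_mul_div_comm, ← natCast_cpow_add_four_mul]
    ring
  rwa [e] at h

theorem P_eq_tsum_primTail {β : ℂ} (hβ : 0 ≤ β.re) (w : ℕ) (z : ℂ) :
    P w z β = prefactor β w * ∑' n : ℕ+, ((ArithmeticFunction.moebius (n : ℕ) : ℤ) : ℂ) /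
      ((n : ℕ) : ℂ) ^ (2 * β) * primTail β w (z / ((n : ℕ) : ℂ) ^ 2) := by
  rw [(hasSum_moebius_mul_primTail hβ w z).tsum_eq, P, prefactor]

theorem P_eq_tsum_T0 {β : ℂ} (hβ : 0 ≤ β.re) (w : ℕ) (z : ℂ) :
    Summable (fun n : ℕ+ =>
      ‖((ArithmeticFunction.moebius (n : ℕ) : ℤ) : ℂ) / ((n : ℕ) : ℂ) ^ (2 * β) *
        T0 (I * z / ((n : ℕ) : ℂ) ^ 2) β w‖) ∧
    P w (Real.pi * z) β =
      ∑' n : ℕ+, ((ArithmeticFunction.moebius (n : ℕ) : ℤ) : ℂ) / ((n : ℕ) : ℂ) ^ (2 * β) *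
        T0 (I * z / ((n : ℕ) : ℂ) ^ 2) β w := by
  have e (n : ℕ+) : ((ArithmeticFunction.moebius (n : ℕ) : ℤ) : ℂ) / ((n : ℕ) : ℂ) ^ (2 * β) *
        T0 (I * z / ((n : ℕ) : ℂ) ^ 2) β w = prefactor β w *
        (((ArithmeticFunction.moebius (n : ℕ) : ℤ) : ℂ) / ((n : ℕ) : ℂ) ^ (2 * β) *
          primTail β w (Real.pi * z / ((n : ℕ) : ℂ) ^ 2)) := by
    rw [T0_eq]
    ring
  simp only [e, tsum_mul_left, norm_mul (prefactor β w)]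
  exact ⟨(summable_norm_moebius_mul_primTail hβ w _).mul_left _, P_eq_tsum_primTail hβ w _⟩

/-! ### Bounds for `₁F₁(1; 1 + β; ·)` on the imaginary axis -/

theorem hasDerivAt_ofReal_cpow {u : ℝ} (hu : 0 < u) (a : ℂ) :
    HasDerivAt (fun t : ℝ => (t : ℂ) ^ a) (a * (u : ℂ) ^ (a - 1)) u := by
  have h := ((hasDerivAt_id (u : ℂ)).cpow_const (c := a) (by simp [hu])).comp_ofReal
  simpa using h

theorem hasDerivAt_ofReal_exp_mul (c : ℂ) (u : ℝ) :
    HasDerivAt (fun t : ℝ => exp (-(c * t))) (-c * exp (-(c * u))) u := by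
  have h := ((hasDerivAt_id (u : ℂ)).const_mul c).fun_neg.cexp.comp_ofReal
  simp only [id, mul_one] at h
  convert! h using 1
  ring

theorem norm_exp_neg_mul_ofReal {c : ℂ} (hc : c.re = 0) (u : ℝ) : ‖exp (-(c * u))‖ = 1 := by
  simp [norm_exp, hc]

/-- A function on `[1, ∞)` whose derivative is `O(t^(a - 1))` grows at most like `t^a`. -/
theorem norm_le_of_norm_deriv_le_rpow {F F' : ℝ → ℂ} {a K : ℝ} (ha : a ≠ 0)
    (hF : ∀ t, 1 ≤ t → HasDerivAt F (F' t) t)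
    (hF' : ∀ t, 1 ≤ t → ‖F' t‖ ≤ K * t ^ (a - 1)) {u : ℝ} (hu : 1 ≤ u) :
    ‖F u‖ ≤ ‖F 1‖ + K / a * (u ^ a - 1) := by
  have hB (t : ℝ) (ht : 1 ≤ t) : HasDerivAt (fun t : ℝ => ‖F 1‖ + K / a * (t ^ a - 1))
      (K * t ^ (a - 1)) t := by
    have h := (((Real.hasDerivAt_rpow_const (p := a) (Or.inl (by linarith : t ≠ 0))).sub_const
      1).const_mul (K / a)).const_add ‖F 1‖
    convert! h using 1
    field_simp
  exact image_norm_le_of_norm_deriv_right_le_deriv_boundary' (a := 1) (b := u)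
    (fun t ht => (hF t ht.1).continuousAt.continuousWithinAt)
    (fun t ht => (hF t ht.1).hasDerivWithinAt) (by simp)
    (fun t ht => (hB t ht.1).continuousAt.continuousWithinAt)
    (fun t ht => (hB t ht.1).hasDerivWithinAt) (fun t ht => hF' t ht.1) ⟨hu, le_rfl⟩

theorem hasDerivAt_kummer_mul {β : ℂ} (hβ : 0 ≤ β.re) (c : ℂ) (u : ℝ) :
    HasDerivAt (fun t : ℝ => kummer β (c * t)) (deriv (kummer β) (c * u) * c) u := by
  have h1 : HasDerivAt (fun z : ℂ => c * z) c (u : ℂ) := by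
    simpa using (hasDerivAt_id (u : ℂ)).const_mul c
  exact ((hasDerivAt_kummer hβ (c * u)).comp (u : ℂ) h1).comp_ofReal

theorem cpow_eq_cpow_sub_one_mul {u : ℝ} (hu : 0 < u) (a : ℂ) :
    (u : ℂ) ^ a = (u : ℂ) ^ (a - 1) * u := by
  have h0 : (u : ℂ) ≠ 0 := by exact_mod_cast hu.ne'
  rw [cpow_sub _ _ h0, cpow_one, div_mul_cancel₀ _ h0]

/-- The integrated form of the differential equation along a ray. -/
theorem hasDerivAt_cpow_mul_exp_mul_kummer {β : ℂ} (hβ : 0 ≤ β.re) (c : ℂ) {u : ℝ} (hu : 0 < u) :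
    HasDerivAt (fun t : ℝ => (t : ℂ) ^ β * exp (-(c * t)) * kummer β (c * t))
      (β * (u : ℂ) ^ (β - 1) * exp (-(c * u))) u := by
  have h := ((hasDerivAt_ofReal_cpow hu β).fun_mul (hasDerivAt_ofReal_exp_mul c u)).fun_mul
    (hasDerivAt_kummer_mul hβ c u)
  convert! h using 1
  have e := mul_deriv_kummer hβ (c * u)
  rw [cpow_eq_cpow_sub_one_mul hu β]
  linear_combination (-(u : ℂ) ^ (β - 1) * exp (-(c * u))) * e

/-- For `Re β > 0` the function `₁F₁(1; 1 + β; ·)` is bounded on the imaginary axis. -/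
theorem exists_norm_kummer_le_of_re_pos {β : ℂ} (hβ : 0 < β.re) {c : ℂ} (hc : c.re = 0) :
    ∃ C, ∀ u : ℝ, 1 ≤ u → ‖kummer β (c * u)‖ ≤ C := by
  set F : ℝ → ℂ := fun t => (t : ℂ) ^ β * exp (-(c * t)) * kummer β (c * t) with hF
  refine ⟨‖F 1‖ + ‖β‖ / β.re, fun u hu => ?_⟩
  have hu0 : 0 < u := by linarith
  have h := norm_le_of_norm_deriv_le_rpow (F := F) (a := β.re) (K := ‖β‖) hβ.ne'
    (fun t ht => hasDerivAt_cpow_mul_exp_mul_kummer hβ.le c (by linarith)) (fun t ht => by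
      rw [norm_mul, norm_mul, norm_exp_neg_mul_ofReal hc,
        norm_cpow_eq_rpow_re_of_pos (by linarith)]
      simp) hu
  have e : ‖F u‖ = u ^ β.re * ‖kummer β (c * u)‖ := by
    rw [hF]
    simp only [norm_mul, norm_exp_neg_mul_ofReal hc, norm_cpow_eq_rpow_re_of_pos hu0, mul_one]
  have h1 : 1 ≤ u ^ β.re := Real.one_le_rpow hu hβ.le
  have h2 : 0 ≤ ‖β‖ / β.re := by positivity
  rw [e] at h
  have h3 : u ^ β.re * ‖kummer β (c * u)‖ ≤ u ^ β.re * (‖F 1‖ + ‖β‖ / β.re) := by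
    nlinarith [norm_nonneg (F 1)]
  exact le_of_mul_le_mul_left h3 (by linarith)

/-- For `0 ≤ Re β < 1` the function `₁F₁(1; 1 + β; ·)` decays like `u^(-Re β)` on the
imaginary axis. -/
theorem exists_norm_kummer_le_rpow {β : ℂ} (hβ : 0 ≤ β.re) (hβ1 : β.re < 1) {c : ℂ}
    (hc : c.re = 0) (hn : ‖c‖ = 1) :
    ∃ C, ∀ u : ℝ, 1 ≤ u → ‖kummer β (c * u)‖ ≤ C * u ^ (-β.re) := by
  have hc0 : c ≠ 0 := fun h => by simp [h] at hn
  set G : ℝ → ℂ := fun t => (t : ℂ) ^ β * exp (-(c * t)) * kummer β (c * t) with hG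
  -- The added term is the boundary term of one integration by parts of G'. It cancels the t^(β-1)
  -- part of the derivative, leaving t^(β-2), which is integrable at infinity.
  set F : ℝ → ℂ := fun t => G t + β / c * ((t : ℂ) ^ (β - 1) * exp (-(c * t))) with hF
  have hd (t : ℝ) (ht : 1 ≤ t) :
      HasDerivAt F (β / c * (β - 1) * (t : ℂ) ^ (β - 1 - 1) * exp (-(c * t))) t := by
    have ht0 : 0 < t := by linarith
    have h := (hasDerivAt_cpow_mul_exp_mul_kummer hβ c ht0).add
      (((hasDerivAt_ofReal_cpow ht0 (β - 1)).mul (hasDerivAt_ofReal_exp_mul c t)).const_mul (β / c))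
    convert! h using 1
    field_simp
    ring
  set K : ℝ := ‖β / c * (β - 1)‖
  have hK : 0 ≤ K := norm_nonneg _
  refine ⟨‖F 1‖ + K / (1 - β.re) + ‖β‖, fun u hu => ?_⟩
  have hu0 : 0 < u := by linarith
  have h := norm_le_of_norm_deriv_le_rpow (F := F) (a := β.re - 1) (K := K) (by linarith) hd
    (fun t ht => by
      rw [norm_mul, norm_mul, norm_exp_neg_mul_ofReal hc,
        norm_cpow_eq_rpow_re_of_pos (by linarith)]
      simp [K]) hu
  have e : ‖G u‖ = u ^ β.re * ‖kummer β (c * u)‖ := by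
    rw [hG]
    simp only [norm_mul, norm_exp_neg_mul_ofReal hc, norm_cpow_eq_rpow_re_of_pos hu0, mul_one]
  have h1 : u ^ (β.re - 1) ≤ 1 := Real.rpow_le_one_of_one_le_of_nonpos hu (by linarith)
  have h0 : 0 ≤ u ^ (β.re - 1) := by positivity
  have h2 : ‖G u‖ ≤ ‖F u‖ + ‖β‖ := by
    have e2 : G u = F u - β / c * ((u : ℂ) ^ (β - 1) * exp (-(c * u))) := by simp [hF]
    rw [e2]
    refine (norm_sub_le _ _).trans ?_
    gcongr
    rw [norm_mul, norm_mul, norm_exp_neg_mul_ofReal hc, norm_cpow_eq_rpow_re_of_pos hu0, norm_div,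
      hn]
    simpa using mul_le_of_le_one_right (norm_nonneg β) h1
  have h3 : K / (β.re - 1) * (u ^ (β.re - 1) - 1) ≤ K / (1 - β.re) := by
    rw [show K / (β.re - 1) * (u ^ (β.re - 1) - 1) = K / (1 - β.re) * (1 - u ^ (β.re - 1)) by
      rw [← neg_sub 1 β.re, div_neg]; ring]
    exact mul_le_of_le_one_right (div_nonneg hK (by linarith)) (by linarith)
  rw [Real.rpow_neg hu0.le, ← div_eq_mul_inv, le_div_iff₀ (by positivity), mul_comm, ← e]
  linarith

/-- For Re β = 0 the direct estimate of the derivative by t^(-1) would give a logarithm; the decay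
estimate still applies there, with exponent 0. -/
theorem exists_norm_kummer_le {β : ℂ} (hβ : 0 ≤ β.re) {c : ℂ} (hc : c.re = 0) (hn : ‖c‖ = 1) :
    ∃ C, ∀ u : ℝ, 0 ≤ u → ‖kummer β (c * u)‖ ≤ C := by
  obtain ⟨C, hC⟩ : ∃ C, ∀ u : ℝ, 1 ≤ u → ‖kummer β (c * u)‖ ≤ C := by
    rcases hβ.lt_or_eq with h | h
    · exact exists_norm_kummer_le_of_re_pos h hc
    · obtain ⟨C, hC⟩ := exists_norm_kummer_le_rpow hβ (by linarith) hc hn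
      exact ⟨C, fun u hu => by simpa [← h] using hC u hu⟩
  obtain ⟨D, hD⟩ := (isCompact_Icc (a := (0 : ℝ)) (b := 1)).exists_bound_of_continuousOn
    (f := fun u : ℝ => kummer β (c * u))
    (fun u _ => (hasDerivAt_kummer_mul hβ c u).continuousAt.continuousWithinAt)
  refine ⟨max C D, fun u hu => ?_⟩
  rcases le_total 1 u with h | h
  · exact (hC u h).trans (le_max_left _ _)
  · exact (hD u ⟨hu, h⟩).trans (le_max_right _ _)

theorem exists_norm_cosSeries_le {β : ℂ} (hβ : 0 ≤ β.re) :
    ∃ C, ∀ u : ℝ, 0 ≤ u → ‖cosSeries β u‖ ≤ C := by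
  obtain ⟨C, hC⟩ := exists_norm_kummer_le hβ I_re norm_I
  obtain ⟨D, hD⟩ := exists_norm_kummer_le hβ (c := -I) (by simp) (by simp)
  refine ⟨(C + D) / 2, fun u hu => ?_⟩
  rw [cosSeries, norm_div, norm_ofNat]
  gcongr
  exact (norm_add_le _ _).trans (add_le_add (hC u hu) (hD u hu))

theorem exists_norm_cosSeries_le_rpow {β : ℂ} (hβ : 0 ≤ β.re) (hβ1 : β.re < 1) :
    ∃ C, ∀ u : ℝ, 1 ≤ u → ‖cosSeries β u‖ ≤ C * u ^ (-β.re) := by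
  obtain ⟨C, hC⟩ := exists_norm_kummer_le_rpow hβ hβ1 I_re norm_I
  obtain ⟨D, hD⟩ := exists_norm_kummer_le_rpow hβ hβ1 (c := -I) (by simp) (by simp)
  refine ⟨(C + D) / 2, fun u hu => ?_⟩
  rw [cosSeries, norm_div, norm_ofNat, div_mul_eq_mul_div, add_mul]
  gcongr
  exact (norm_add_le _ _).trans (add_le_add (hC u hu) (hD u hu))

/-- At infinity `cosTail β w` is of order `2 w`. -/
theorem exists_norm_cosTail_le {β : ℂ} (hβ : 0 ≤ β.re) (w : ℕ) :
    ∃ C, ∀ u : ℝ, 1 ≤ u → ‖cosTail β w u‖ ≤ C * u ^ (2 * w) := by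
  obtain ⟨C, hC⟩ := exists_norm_cosSeries_le hβ
  have hC0 : 0 ≤ C := (norm_nonneg _).trans (hC 0 le_rfl)
  refine ⟨C + (w + 1), fun u hu => ?_⟩
  rw [cosTail_eq hβ, add_mul]
  refine (norm_sub_le _ _).trans (add_le_add ?_ ?_)
  · exact (hC u (by linarith)).trans (le_mul_of_one_le_right hC0 (one_le_pow₀ hu))
  · refine (norm_sum_le_of_le (f := cosTerm β u) (n := fun _ => u ^ (2 * w)) _
      fun k hk => ?_).trans (by simp)
    refine (norm_cosTerm_le hβ u k).trans ?_
    rw [norm_real, Real.norm_of_nonneg (by linarith)]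
    refine (div_le_self (by positivity) (by exact_mod_cast Nat.factorial_pos _)).trans ?_
    exact pow_le_pow_right₀ hu (by have := Finset.mem_range.mp hk; lia)

/-! ### Mellin transforms of multiplicative convolutions -/

theorem integral_norm_cpow_mul_comp_mul_left (G : ℝ → ℂ) (s : ℂ) {t : ℝ} (ht : 0 < t) :
    ∫ x in Ioi (0 : ℝ), ‖(x : ℂ) ^ (s - 1) * G (t * x)‖ =
      t ^ (-s.re) * ∫ x in Ioi (0 : ℝ), ‖(x : ℂ) ^ (s - 1) * G x‖ := by
  have h := integral_comp_mul_left_Ioi (fun x : ℝ => ‖(x : ℂ) ^ (s - 1) * G x‖) 0 ht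
  rw [mul_zero, smul_eq_mul] at h
  rw [show t ^ (-s.re) = t ^ (1 - s.re) * t⁻¹ by
    rw [← Real.rpow_neg_one, ← Real.rpow_add ht]; congr 1; ring, mul_assoc, ← h,
    ← integral_const_mul]
  refine setIntegral_congr_fun measurableSet_Ioi fun x hx => ?_
  have hx : 0 < x := hx
  simp only [norm_mul]
  rw [norm_cpow_eq_rpow_re_of_pos hx, norm_cpow_eq_rpow_re_of_pos (mul_pos ht hx),
    Real.mul_rpow ht.le hx.le, ← mul_assoc, ← mul_assoc, ← Real.rpow_add ht]
  simp

/-- The Mellin transform of a multiplicative convolution is a product of Mellin transforms. -/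
theorem hasMellin_mul_convolution {φ G F : ℝ → ℂ} {s : ℂ} (hφm : Measurable φ)
    (hGm : Measurable G) (hφ : MellinConvergent φ (1 - s)) (hG : MellinConvergent G s)
    (hF : ∀ x : ℝ, 0 < x → F x = ∫ t in Ioi (0 : ℝ), φ t * G (x * t)) :
    HasMellin F s (mellin φ (1 - s) * mellin G s) := by
  set μ : Measure ℝ := volume.restrict (Ioi 0) with hμ
  set K : ℝ → ℝ → ℂ := fun t x => φ t * ((x : ℂ) ^ (s - 1) * G (t * x)) with hK
  have hKm : Measurable (Function.uncurry K) := by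
    rw [hK]
    unfold Function.uncurry
    fun_prop
  have hφ' : Integrable (fun t : ℝ => φ t * (t : ℂ) ^ (-s)) μ := by
    refine hφ.congr (.of_forall fun t => ?_)
    simp only [smul_eq_mul, sub_sub_cancel_left]
    ring
  -- Fubini's condition: by scaling, the inner integral of the norm is a constant times t^(-Re s),
  -- and φ(t) t^(-s) is integrable because the Mellin integral of φ converges at 1 - s.
  have hKi : Integrable (Function.uncurry K) (μ.prod μ) := by
    rw [integrable_prod_iff hKm.aestronglyMeasurable]
    constructor
    · refine (ae_restrict_mem measurableSet_Ioi).mono fun t ht => ?_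
      have h := (MellinConvergent.comp_mul_left (f := G) (s := s) ht).mpr hG
      exact Integrable.const_mul h (φ t)
    · refine (hφ'.norm.mul_const (∫ x in Ioi (0 : ℝ), ‖(x : ℂ) ^ (s - 1) * G x‖)).congr ?_
      refine (ae_restrict_mem measurableSet_Ioi).mono fun t ht => ?_
      have ht : 0 < t := ht
      simp only [Function.uncurry, hK, norm_mul (φ t)]
      rw [integral_const_mul, integral_norm_cpow_mul_comp_mul_left G s ht, ← mul_assoc,
        norm_cpow_eq_rpow_re_of_pos ht, neg_re]
  have hFK : (fun x : ℝ => (x : ℂ) ^ (s - 1) • F x) =ᵐ[μ] fun x => ∫ t, K t x ∂μ := by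
    refine (ae_restrict_mem measurableSet_Ioi).mono fun x hx => ?_
    simp only [hK, smul_eq_mul]
    rw [hF x hx, ← integral_const_mul]
    refine integral_congr_ae (.of_forall fun t => ?_)
    simp only [mul_comm x t]
    ring
  refine ⟨(hKi.integral_prod_right).congr hFK.symm, ?_⟩
  rw [mellin, integral_congr_ae hFK, ← integral_integral_swap hKi, mellin, ← integral_mul_const]
  refine setIntegral_congr_fun measurableSet_Ioi fun t ht => ?_
  have h := mellin_comp_mul_left G s ht
  simp only [mellin, smul_eq_mul] at h
  simp only [hK]
  rw [integral_const_mul, h]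
  simp only [mellin, smul_eq_mul, sub_sub_cancel_left]
  ring

/-! ### Gamma integrals -/

theorem hasMellin_exp_neg_mul_cpow {β s : ℂ} (hs : 0 < (s + β).re) :
    HasMellin (fun t : ℝ => exp (-t) * (t : ℂ) ^ β) s (Gamma (s + β)) := by
  have e : ∀ t ∈ Ioi (0 : ℝ), ((Real.exp (-t) : ℝ) : ℂ) * (t : ℂ) ^ (s + β - 1) =
      (t : ℂ) ^ (s - 1) • (exp (-t) * (t : ℂ) ^ β) := by
    intro t ht
    have ht0 : (t : ℂ) ≠ 0 := by exact_mod_cast (ne_of_gt ht)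
    rw [show s + β - 1 = (s - 1) + β by ring, cpow_add _ _ ht0, smul_eq_mul]
    push_cast
    ring
  constructor
  · exact (integrableOn_congr_fun e measurableSet_Ioi).mp (GammaIntegral_convergent hs)
  · rw [Gamma_eq_integral hs, GammaIntegral, mellin]
    exact setIntegral_congr_fun measurableSet_Ioi fun t ht => (e t ht).symm

theorem hasMellin_exp_neg {s : ℂ} (hs : 0 < s.re) :
    HasMellin (fun t : ℝ => exp (-t)) s (Gamma s) := by
  simpa using hasMellin_exp_neg_mul_cpow (β := 0) (s := s) (by simpa)

theorem integral_exp_neg_mul_cpow {β : ℂ} (hβ : 0 ≤ β.re) :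
    IntegrableOn (fun t : ℝ => exp (-t) * (t : ℂ) ^ β) (Ioi 0) ∧
      ∫ t in Ioi (0 : ℝ), exp (-t) * (t : ℂ) ^ β = Gamma (1 + β) := by
  have h := hasMellin_exp_neg_mul_cpow (β := β) (s := 1) (by simp; linarith)
  simpa [HasMellin, MellinConvergent, mellin] using h

/-- The Mellin transform of `1 / (1 + x)`. -/
theorem hasMellin_inv_one_add {s : ℂ} (h0 : 0 < s.re) (h1 : s.re < 1) :
    HasMellin (fun x : ℝ => ((1 + x : ℝ) : ℂ)⁻¹) s (Gamma (1 - s) * Gamma s) := by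
  have ha := hasMellin_exp_neg (s := 1 - s) (by simpa)
  have hb := hasMellin_exp_neg h0
  rw [← ha.2, ← hb.2]
  -- 1/(1 + x) = ∫ e^(-t) e^(-xt) dt is the convolution of e^(-t) with itself.
  refine hasMellin_mul_convolution (by fun_prop) (by fun_prop) ha.1 hb.1 fun x hx => ?_
  have h := integral_exp_mul_complex_Ioi (a := -((1 + x : ℝ) : ℂ))
    (by rw [neg_re, ofReal_re]; linarith) 0
  rw [ofReal_zero, mul_zero, exp_zero, neg_div_neg_eq, one_div] at h
  rw [← h]
  refine setIntegral_congr_fun measurableSet_Ioi fun t _ => ?_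
  simp only [← exp_add]
  push_cast
  congr 1
  ring

/-! ### A Laplace transform -/

/-- Termwise integration would produce ∑ (cx)^n, which diverges for x ≥ 1. Instead the differential
equation exhibits the difference of the two integrands as the derivative of e^(-t) t^β (₁F₁(cxt) -
1), which vanishes at both ends. Subtracting 1 secures the limit at 0 when Re β = 0. -/
theorem integral_exp_mul_cpow_mul_kummer {β : ℂ} (hβ : 0 ≤ β.re) {c : ℂ} (hc : c.re = 0)
    (hn : ‖c‖ = 1) {x : ℝ} (hx : 0 < x) :
    IntegrableOn (fun t : ℝ => exp (-t) * (t : ℂ) ^ β * kummer β (c * (x * t : ℝ))) (Ioi 0) ∧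
    (1 - c * x) * ∫ t in Ioi (0 : ℝ), exp (-t) * (t : ℂ) ^ β * kummer β (c * (x * t : ℝ)) =
      Gamma (1 + β) := by
  obtain ⟨C, hC⟩ := exists_norm_kummer_le hβ hc hn
  obtain ⟨hi, hG⟩ := integral_exp_neg_mul_cpow hβ
  have hcont : Continuous fun t : ℝ => kummer β (c * (x * t : ℝ)) :=
    (differentiable_kummer hβ).continuous.comp (by fun_prop)
  have hint : IntegrableOn (fun t : ℝ => exp (-t) * (t : ℂ) ^ β * kummer β (c * (x * t : ℝ)))
      (Ioi 0) :=
    hi.mul_bdd (c := C) hcont.aestronglyMeasurable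
      ((ae_restrict_mem measurableSet_Ioi).mono fun t ht => hC _ (mul_pos hx ht).le)
  refine ⟨hint, ?_⟩
  set F : ℝ → ℂ := fun t => exp (-t) * (t : ℂ) ^ β * (kummer β (c * (x * t : ℝ)) - 1) with hF
  have hderiv : ∀ t ∈ Ioi (0 : ℝ), HasDerivAt F (exp (-t) * (t : ℂ) ^ β -
      (1 - c * x) * (exp (-t) * (t : ℂ) ^ β * kummer β (c * (x * t : ℝ)))) t := by
    intro t ht
    have h1 := hasDerivAt_ofReal_exp_mul 1 t
    simp only [one_mul] at h1
    have h2 := hasDerivAt_kummer_mul hβ (c * x) t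
    have h := (h1.fun_mul (hasDerivAt_ofReal_cpow ht β)).fun_mul (h2.sub_const 1)
    have e (t : ℝ) : c * (x * t : ℝ) = c * x * t := by push_cast; ring
    simp only [hF, e]
    convert! h using 1
    have e2 := mul_deriv_kummer hβ (c * x * t)
    rw [cpow_eq_cpow_sub_one_mul ht β]
    linear_combination (-(t : ℂ) ^ (β - 1) * exp (-t)) * e2
  have hF0 : F 0 = 0 := by simp [hF, kummer_zero hβ]
  have hnorm (t : ℝ) (ht : 0 < t) :
      ‖F t‖ = t ^ β.re * Real.exp (-t) * ‖kummer β (c * (x * t : ℝ)) - 1‖ := by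
    simp only [hF, norm_mul, norm_cpow_eq_rpow_re_of_pos ht, norm_exp, neg_re, ofReal_re]
    ring
  have hcont0 : ContinuousWithinAt F (Ici 0) 0 := by
    rw [ContinuousWithinAt, hF0, tendsto_zero_iff_norm_tendsto_zero]
    have hlim : Tendsto (fun t : ℝ => ‖kummer β (c * (x * t : ℝ)) - 1‖) (𝓝[≥] 0) (𝓝 0) := by
      have h : Continuous fun t : ℝ => ‖kummer β (c * (x * t : ℝ)) - 1‖ :=
        (hcont.sub continuous_const).norm
      have h0 := h.tendsto 0
      simp only [mul_zero, ofReal_zero, kummer_zero hβ, sub_self, norm_zero] at h0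
      exact h0.mono_left nhdsWithin_le_nhds
    refine squeeze_zero' (.of_forall fun _ => norm_nonneg _) ?_ hlim
    filter_upwards [self_mem_nhdsWithin, mem_nhdsWithin_of_mem_nhds (Iio_mem_nhds one_pos)]
      with t ht ht1
    rcases eq_or_lt_of_le (show 0 ≤ t from ht) with rfl | ht0
    · simp [hF0]
    · rw [hnorm t ht0]
      refine mul_le_of_le_one_left (norm_nonneg _) ?_
      exact mul_le_one₀ (Real.rpow_le_one ht0.le (le_of_lt ht1) hβ) (Real.exp_pos _).le
        (Real.exp_le_one_iff.mpr (by linarith))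
  have htop : Tendsto F atTop (𝓝 0) := by
    rw [tendsto_zero_iff_norm_tendsto_zero]
    have h := (tendsto_rpow_mul_exp_neg_mul_atTop_nhds_zero β.re 1 one_pos).mul_const (C + 1)
    rw [zero_mul] at h
    refine squeeze_zero' (.of_forall fun _ => norm_nonneg _) ?_ h
    filter_upwards [eventually_gt_atTop 0] with t ht
    rw [hnorm t ht, neg_one_mul]
    gcongr
    refine (norm_sub_le _ _).trans ?_
    rw [norm_one]
    gcongr
    exact hC _ (mul_pos hx ht).le
  have h := integral_Ioi_of_hasDerivAt_of_tendsto hcont0 hderiv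
    (hi.sub (hint.const_mul (1 - c * x))) htop
  rw [integral_sub hi (hint.const_mul _), integral_const_mul, hG, hF0, sub_self] at h
  linear_combination -h

theorem one_add_sq_ne_zero (x : ℝ) : (1 + (x : ℂ) ^ 2) ≠ 0 := by
  have h : (1 + x ^ 2 : ℝ) ≠ 0 := by positivity
  exact_mod_cast h

/-- The mean of 1/(1 - ix) and 1/(1 + ix) is 1/(1 + x²). -/
theorem integral_exp_mul_cpow_mul_cosSeries {β : ℂ} (hβ : 0 ≤ β.re) {x : ℝ} (hx : 0 < x) :
    IntegrableOn (fun t : ℝ => exp (-t) * (t : ℂ) ^ β * cosSeries β (x * t : ℝ)) (Ioi 0) ∧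
    ∫ t in Ioi (0 : ℝ), exp (-t) * (t : ℂ) ^ β * cosSeries β (x * t : ℝ) =
      Gamma (1 + β) / (1 + (x : ℂ) ^ 2) := by
  obtain ⟨h1, e1⟩ := integral_exp_mul_cpow_mul_kummer hβ I_re norm_I hx
  obtain ⟨h2, e2⟩ := integral_exp_mul_cpow_mul_kummer hβ (c := -I) (by simp) (by simp) hx
  have e : (fun t : ℝ => exp (-t) * (t : ℂ) ^ β * cosSeries β (x * t : ℝ)) = fun t : ℝ =>
      (exp (-t) * (t : ℂ) ^ β * kummer β (I * (x * t : ℝ)) +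
        exp (-t) * (t : ℂ) ^ β * kummer β (-I * (x * t : ℝ))) * (1 / 2) := by
    ext t
    rw [cosSeries]
    ring
  rw [e]
  refine ⟨(h1.add h2).mul_const _, ?_⟩
  rw [integral_mul_const, integral_add h1 h2, eq_div_iff (one_add_sq_ne_zero x)]
  set A := ∫ t in Ioi (0 : ℝ), exp (-t) * (t : ℂ) ^ β * kummer β (I * (x * t : ℝ))
  set B := ∫ t in Ioi (0 : ℝ), exp (-t) * (t : ℂ) ^ β * kummer β (-I * (x * t : ℝ))
  linear_combination (1 + I * x) / 2 * e1 + (1 - I * x) / 2 * e2 +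
    (A + B) * x ^ 2 / 2 * I_sq

theorem cosTerm_mul (β : ℂ) (x t : ℂ) (k : ℕ) :
    cosTerm β (x * t) k = cosTerm β x k * t ^ (2 * k) := by
  simp only [cosTerm, mul_pow]
  ring

theorem integral_exp_mul_cpow_mul_cosTerm {β : ℂ} (hβ : 0 ≤ β.re) (x : ℝ) (k : ℕ) :
    IntegrableOn (fun t : ℝ => exp (-t) * (t : ℂ) ^ β * cosTerm β (x * t : ℝ) k) (Ioi 0) ∧
    ∫ t in Ioi (0 : ℝ), exp (-t) * (t : ℂ) ^ β * cosTerm β (x * t : ℝ) k =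
      Gamma (1 + β) * (-(x : ℂ) ^ 2) ^ k := by
  obtain ⟨hi, hG⟩ := integral_exp_neg_mul_cpow (β := β + (2 * k : ℕ))
    (by simp only [add_re, natCast_re]; positivity)
  have e : ∀ t ∈ Ioi (0 : ℝ), cosTerm β x k * (exp (-t) * (t : ℂ) ^ (β + (2 * k : ℕ))) =
      exp (-t) * (t : ℂ) ^ β * cosTerm β (x * t : ℝ) k := by
    intro t ht
    have ht0 : (t : ℂ) ≠ 0 := by exact_mod_cast (ne_of_gt ht)
    rw [cpow_add _ _ ht0, cpow_natCast, ofReal_mul, cosTerm_mul]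
    ring
  refine ⟨(integrableOn_congr_fun e measurableSet_Ioi).mp (hi.const_mul _), ?_⟩
  rw [← setIntegral_congr_fun measurableSet_Ioi e, integral_const_mul, hG, ← add_assoc,
    Gamma_one_add_add_nat hβ, cosTerm, neg_pow ((x : ℂ) ^ 2), ← pow_mul]
  field_simp [poch_ne_zero hβ (2 * k)]

/-- The removed terms integrate to a finite geometric sum of ratio -x², so the remainder of the
geometric series is left. -/
theorem integral_exp_mul_cpow_mul_cosTail {β : ℂ} (hβ : 0 ≤ β.re) (w : ℕ) {x : ℝ} (hx : 0 < x) :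
    ∫ t in Ioi (0 : ℝ), exp (-t) * (t : ℂ) ^ β * cosTail β w (x * t : ℝ) =
      Gamma (1 + β) * ((-(x : ℂ) ^ 2) ^ (w + 1) / (1 + (x : ℂ) ^ 2)) := by
  obtain ⟨h1, e1⟩ := integral_exp_mul_cpow_mul_cosSeries hβ hx
  simp only [cosTail_eq hβ, mul_sub, Finset.mul_sum]
  rw [integral_sub h1 (integrable_finsetSum _ fun k _ =>
    (integral_exp_mul_cpow_mul_cosTerm hβ x k).1), integral_finsetSum _ fun k _ =>
    (integral_exp_mul_cpow_mul_cosTerm hβ x k).1, e1]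
  simp only [(integral_exp_mul_cpow_mul_cosTerm hβ x _).2]
  have hg := geom_sum_mul (-(x : ℂ) ^ 2) (w + 1)
  rw [← Finset.mul_sum, mul_div_assoc', eq_div_iff (one_add_sq_ne_zero x), sub_mul,
    div_mul_cancel₀ _ (one_add_sq_ne_zero x)]
  linear_combination Gamma (1 + β) * hg

/-! ### The Mellin transform of `cosTail` -/

/-- The strip lies between the orders of `cosTail` at infinity, 2w, and at the origin, 2(w + 1). -/
theorem mellinConvergent_cosTail {β : ℂ} (hβ : 0 ≤ β.re) (w : ℕ) {q : ℂ} (h1 : 2 * (w : ℝ) < q.re)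
    (h2 : q.re < 2 * (w + 1)) : MellinConvergent (fun x : ℝ => cosTail β w x) (-q) := by
  obtain ⟨C, hC⟩ := exists_norm_cosTail_le hβ w
  refine mellinConvergent_of_isBigO_rpow (a := -(2 * w : ℕ)) (b := -(2 * (w + 1) : ℕ))
    ?_ ?_ ?_ ?_ ?_
  · exact ((differentiable_cosTail hβ w).continuous.comp
      continuous_ofReal).locallyIntegrable.locallyIntegrableOn _
  · refine .of_bound C ?_
    filter_upwards [eventually_ge_atTop 1] with u hu
    rw [neg_neg, Real.rpow_natCast, Real.norm_of_nonneg (by positivity)]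
    exact hC u hu
  · simpa using h1
  · refine .of_bound (Real.exp 1) ?_
    filter_upwards [self_mem_nhdsWithin, mem_nhdsWithin_of_mem_nhds (Iio_mem_nhds one_pos)]
      with u hu hu1
    have hu : 0 < u := hu
    have e : ‖(u : ℂ)‖ = u := by rw [norm_real, Real.norm_of_nonneg hu.le]
    have h := norm_cosTail_le hβ w (z := u) (by rw [e]; exact le_of_lt hu1)
    rw [neg_neg, Real.rpow_natCast, Real.norm_of_nonneg (by positivity)]
    rwa [e] at h
  · simpa using h2

theorem mellin_pow_div_one_add_sq (w : ℕ) {q : ℂ} (h1 : 2 * (w : ℝ) < q.re)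
    (h2 : q.re < 2 * (w + 1)) :
    mellin (fun x : ℝ => (-(x : ℂ) ^ 2) ^ (w + 1) / (1 + (x : ℂ) ^ 2)) (-q) =
      -(Real.pi / (2 * sin (Real.pi * q / 2))) := by
  -- After replacing x² by x the exponent is w + 1 - q/2, which has real part in (0, 1). The sign
  -- (-1)^w of sin(πs) meets (-1)^(w+1) from the numerator, so the result does not depend on w.
  set s : ℂ := (-q + (2 * (w + 1) : ℕ)) / (2 : ℝ) with hs
  have hre : s.re = (-q.re + 2 * (w + 1)) / 2 := by
    rw [hs, div_ofReal_re]
    simp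
  have hm := (hasMellin_inv_one_add (s := s) (by rw [hre]; linarith) (by rw [hre]; linarith)).2
  have hr := mellin_comp_rpow (fun x : ℝ => ((1 + x : ℝ) : ℂ)⁻¹) (-q + (2 * (w + 1) : ℕ)) 2
  have hp := mellin_cpow_smul (fun x : ℝ => ((1 + x ^ (2 : ℝ) : ℝ) : ℂ)⁻¹) (-q) (2 * (w + 1) : ℕ)
  rw [hr, ← hs, hm] at hp
  have e : (fun x : ℝ => (-(x : ℂ) ^ 2) ^ (w + 1) / (1 + (x : ℂ) ^ 2)) = fun x : ℝ =>
      ((-1 : ℂ) ^ (w + 1)) • ((x : ℂ) ^ (((2 * (w + 1) : ℕ) : ℂ)) •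
        ((1 + x ^ (2 : ℝ) : ℝ) : ℂ)⁻¹) := by
    ext x
    rw [cpow_natCast, neg_pow, pow_mul, smul_eq_mul, smul_eq_mul]
    push_cast [Real.rpow_two]
    ring
  rw [e, mellin_const_smul, hp, mul_comm (Gamma _), Gamma_mul_Gamma_one_sub]
  have hsin : sin (Real.pi * s) = (-1) ^ w * sin (Real.pi * q / 2) := by
    have : (Real.pi : ℂ) * s = (Real.pi - Real.pi * q / 2) + w * Real.pi := by
      rw [hs]
      push_cast
      ring
    rw [this, sin_antiperiodic.add_nat_mul_eq, sin_pi_sub]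
  rw [hsin, smul_eq_mul, pow_succ]
  have h1 : ((-1 : ℂ) ^ w) ≠ 0 := pow_ne_zero _ (by norm_num)
  simp only [abs_of_pos (two_pos : (0 : ℝ) < 2), real_smul]
  push_cast
  rw [div_mul_eq_div_div _ ((-1 : ℂ) ^ w), div_mul_eq_div_div _ (2 : ℂ)]
  field_simp

/-- The convolution with e^(-t) t^β and its transform are both known; dividing by the nonzero Γ(1 +
β + q) isolates the unknown factor. -/
theorem mellin_cosTail {β : ℂ} (hβ : 0 ≤ β.re) (w : ℕ) {q : ℂ} (h1 : 2 * (w : ℝ) < q.re)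
    (h2 : q.re < 2 * (w + 1)) :
    mellin (fun x : ℝ => cosTail β w x) (-q) =
      -(Real.pi * Gamma (1 + β) / (2 * sin (Real.pi * q / 2) * Gamma (1 + β + q))) := by
  have hq : 0 ≤ q.re := by
    have : (0 : ℝ) ≤ w := w.cast_nonneg
    linarith
  have hG : 0 < (1 - -q + β).re := by simp; linarith
  have hφ := hasMellin_exp_neg_mul_cpow hG
  have h := (hasMellin_mul_convolution (φ := fun t : ℝ => exp (-t) * (t : ℂ) ^ β)
    (F := fun x : ℝ => Gamma (1 + β) • ((-(x : ℂ) ^ 2) ^ (w + 1) / (1 + (x : ℂ) ^ 2)))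
    (by fun_prop) ((differentiable_cosTail hβ w).continuous.comp continuous_ofReal).measurable
    hφ.1 (mellinConvergent_cosTail hβ w h1 h2)
    (fun x hx => (integral_exp_mul_cpow_mul_cosTail hβ w hx).symm)).2
  rw [mellin_const_smul, mellin_pow_div_one_add_sq w h1 h2, hφ.2] at h
  have hne := Gamma_ne_zero_of_re_pos hG
  rw [show 1 + β + q = 1 - -q + β by ring, ← mul_right_inj' hne]
  rw [smul_eq_mul] at h
  simp only [Function.comp_def] at h
  rw [← h, div_mul_eq_div_div _ _ (Gamma _)]
  field_simp

/-! ### The Mellin transform of `primTail` -/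

theorem cpow_mul_cosTerm_mul (β z : ℂ) (k : ℕ) {t : ℝ} (ht : 0 < t) :
    (t : ℂ) ^ (β - 3 / 2) * cosTerm β (z * t) k =
      cosTerm β z k * (t : ℂ) ^ (2 * (k : ℂ) + β - 3 / 2) := by
  rw [cosTerm_mul, show 2 * (k : ℂ) + β - 3 / 2 = (β - 3 / 2) + (2 * k : ℕ) by push_cast; ring,
    cpow_add _ _ (by exact_mod_cast ht.ne'), cpow_natCast]
  ring

theorem half_le_re_two_mul_add {β : ℂ} (hβ : 0 ≤ β.re) {k : ℕ} (hk : 1 ≤ k) :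
    1 / 2 ≤ (2 * (k : ℂ) + β - 3 / 2).re := by
  have : (1 : ℝ) ≤ k := by exact_mod_cast hk
  simp
  linarith

theorem integral_cpow_mul_cosTerm {β : ℂ} (hβ : 0 ≤ β.re) (z : ℂ) {k : ℕ} (hk : 1 ≤ k) :
    ∫ t in Ioc (0 : ℝ) 1, (t : ℂ) ^ (β - 3 / 2) * cosTerm β (z * t) k = primTerm β z k := by
  have hre := half_le_re_two_mul_add hβ hk
  have h0 : 2 * (k : ℂ) + β - 1 / 2 ≠ 0 :=
    norm_pos_iff.mp (one_pos.trans_le (one_le_norm_two_mul_add hβ hk))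
  rw [setIntegral_congr_fun measurableSet_Ioc fun t ht => cpow_mul_cosTerm_mul β z k ht.1,
    integral_const_mul, ← intervalIntegral.integral_of_le zero_le_one,
    integral_cpow (Or.inl (by linarith)),
    show 2 * (k : ℂ) + β - 3 / 2 + 1 = 2 * (k : ℂ) + β - 1 / 2 by ring, ofReal_one, ofReal_zero,
    one_cpow, zero_cpow h0, primTerm]
  ring

theorem norm_cpow_mul_cosTerm_le {β : ℂ} (hβ : 0 ≤ β.re) (z : ℂ) {k : ℕ} (hk : 1 ≤ k) {t : ℝ}
    (ht : t ∈ Ioc (0 : ℝ) 1) :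
    ‖(t : ℂ) ^ (β - 3 / 2) * cosTerm β (z * t) k‖ ≤ ‖cosTerm β z k‖ := by
  rw [cpow_mul_cosTerm_mul β z k ht.1, norm_mul, norm_cpow_eq_rpow_re_of_pos ht.1]
  refine mul_le_of_le_one_right (norm_nonneg _) (Real.rpow_le_one ht.1.le ht.2 ?_)
  linarith [half_le_re_two_mul_add hβ hk]

/-- Each denominator 2k + β - 1/2 is the integral of a power of t over (0, 1]; for k ≥ 1 that power
is bounded by 1, which dominates the series. -/
theorem primTail_eq_integral {β : ℂ} (hβ : 0 ≤ β.re) (w : ℕ) (z : ℂ) :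
    primTail β w z = ∫ t in Ioc (0 : ℝ) 1, (t : ℂ) ^ (β - 3 / 2) * cosTail β w (z * t) := by
  have hs := (summable_nat_add_iff (f := fun k => ‖cosTerm β z k‖) (w + 1)).mpr
    (summable_norm_cosTerm hβ z)
  have h : HasSum (fun j : ℕ => ∫ t in Ioc (0 : ℝ) 1,
      (t : ℂ) ^ (β - 3 / 2) * cosTerm β (z * t) (j + (w + 1)))
      (∫ t in Ioc (0 : ℝ) 1, (t : ℂ) ^ (β - 3 / 2) * cosTail β w (z * t)) := by
    refine hasSum_integral_of_dominated_convergence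
      (bound := fun j _ => ‖cosTerm β z (j + (w + 1))‖) (fun j => ?_) (fun j => ?_) ?_ ?_ ?_
    · have : Measurable fun t : ℝ => (t : ℂ) ^ (β - 3 / 2) * cosTerm β (z * t) (j + (w + 1)) := by
        unfold cosTerm
        fun_prop
      exact this.aestronglyMeasurable
    · exact (ae_restrict_mem measurableSet_Ioc).mono fun t ht =>
        norm_cpow_mul_cosTerm_le hβ z (by lia) ht
    · exact .of_forall fun t => hs
    · exact integrable_const _
    · exact .of_forall fun t => (hasSum_cosTail hβ w _).mul_left _
  rw [← h.tsum_eq, primTail]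
  exact tsum_congr fun j => (integral_cpow_mul_cosTerm hβ z (by lia)).symm

/-- The hypothesis `h3` is the convergence at 0 of ∫ t^(q+β-3/2) dt. -/
theorem hasMellin_primTail {β : ℂ} (hβ : 0 ≤ β.re) (w : ℕ) {q : ℂ} (h1 : 2 * (w : ℝ) < q.re)
    (h2 : q.re < 2 * (w + 1)) (h3 : 1 / 2 - β.re < q.re) :
    HasMellin (fun x : ℝ => primTail β w x) (-q)
      (1 / (q + β - 1 / 2) * mellin (fun x : ℝ => cosTail β w x) (-q)) := by
  have hφ := hasMellin_cpow_Ioc (β - 3 / 2) (s := 1 - -q) (by simp; linarith)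
  have h := hasMellin_mul_convolution (φ := indicator (Ioc 0 1) fun t : ℝ => (t : ℂ) ^ (β - 3 / 2))
    (F := fun x : ℝ => primTail β w x) (Measurable.indicator (by fun_prop) measurableSet_Ioc)
    ((differentiable_cosTail hβ w).continuous.comp continuous_ofReal).measurable
    hφ.1 (mellinConvergent_cosTail hβ w h1 h2) (fun x hx => by
      rw [primTail_eq_integral hβ]
      have e (t : ℝ) : (Ioc (0 : ℝ) 1).indicator (fun t : ℝ => (t : ℂ) ^ (β - 3 / 2)) t *
          (cosTail β w ∘ ofReal) (x * t) = (Ioc (0 : ℝ) 1).indicator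
            (fun t : ℝ => (t : ℂ) ^ (β - 3 / 2) * cosTail β w (x * t)) t := by
        rw [indicator_mul_left]
        simp
      simp only [e]
      rw [setIntegral_indicator measurableSet_Ioc, inter_eq_right.mpr Ioc_subset_Ioi_self])
  rw [hφ.2] at h
  convert! h using 3
  ring

/-! ### The Mellin transform of `P` -/

theorem integrable_of_summable_integral_norm {α ι : Type*} [Countable ι] [MeasurableSpace α]
    {μ : Measure α} {F : ι → α → ℂ} {G : α → ℂ} (hF : ∀ i, Integrable (F i) μ)
    (hs : Summable fun i => ∫ x, ‖F i x‖ ∂μ) (hG : AEStronglyMeasurable G μ)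
    (h : ∀ x, HasSum (fun i => F i x) (G x)) : Integrable G μ := by
  refine ⟨hG, ?_⟩
  have e (i : ι) : ∫⁻ x, ‖F i x‖ₑ ∂μ = ENNReal.ofReal (∫ x, ‖F i x‖ ∂μ) :=
    (ofReal_integral_norm_eq_lintegral_enorm (hF i)).symm
  calc ∫⁻ x, ‖G x‖ₑ ∂μ ≤ ∫⁻ x, ∑' i, ‖F i x‖ₑ ∂μ := by
        refine lintegral_mono fun x => ?_
        rw [← (h x).tsum_eq]
        exact enorm_tsum_le_tsum_enorm
    _ = ENNReal.ofReal (∑' i, ∫ x, ‖F i x‖ ∂μ) := by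
        rw [lintegral_tsum fun i => (hF i).1.enorm,
          ENNReal.ofReal_tsum_of_nonneg (fun i => integral_nonneg fun x => norm_nonneg _) hs]
        exact tsum_congr e
    _ < ⊤ := ENNReal.ofReal_lt_top

/-- Rescaling by n^(-2) multiplies the transform at -q by n^(-2q), so the Möbius sum becomes the
Dirichlet series of 1/ζ at 2β + 2q. Here `h3` says that this series converges absolutely, which also
permits summing under the integral. -/
theorem hasMellin_P {β : ℂ} (hβ : 0 ≤ β.re) (w : ℕ) {q : ℂ} (h1 : 2 * (w : ℝ) < q.re)
    (h2 : q.re < 2 * (w + 1)) (h3 : 1 / 2 - β.re < q.re) :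
    HasMellin (fun x : ℝ => P w x β) (-q) (prefactor β w * ((riemannZeta (2 * β + 2 * q))⁻¹ *
      mellin (fun x : ℝ => primTail β w x) (-q))) := by
  set μ : Measure ℝ := volume.restrict (Ioi 0)
  set M : ℕ+ → ℂ := fun n => ((ArithmeticFunction.moebius (n : ℕ) : ℤ) : ℂ) /
      ((n : ℕ) : ℂ) ^ (2 * β) with hM
  set S : ℝ → ℂ := fun x => primTail β w x with hS
  set F : ℕ+ → ℝ → ℂ := fun n x =>
    prefactor β w * M n * ((x : ℂ) ^ (-q - 1) * S ((((n : ℕ) : ℝ) ^ 2)⁻¹ * x)) with hF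
  have hSm := hasMellin_primTail hβ w h1 h2 h3
  have hn0 (n : ℕ+) : (0 : ℝ) < (n : ℕ) := by exact_mod_cast n.pos
  have hn (n : ℕ+) : 0 < (((n : ℕ) : ℝ) ^ 2)⁻¹ := inv_pos.mpr (pow_pos (hn0 n) 2)
  have hre : 1 < (2 * β + 2 * q).re := by simp; linarith
  have hFi (n : ℕ+) : Integrable (F n) μ :=
    Integrable.const_mul ((MellinConvergent.comp_mul_left (hn n)).mpr hSm.1) _
  have hpow (n : ℕ+) : (((n : ℕ) : ℝ) ^ 2)⁻¹ ^ q.re = ((n : ℕ) : ℝ) ^ (-(2 * q.re)) := by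
    rw [← Real.rpow_natCast, ← Real.rpow_neg (hn0 n).le, ← Real.rpow_mul (hn0 n).le]
    congr 1
    push_cast
    ring
  have hsum : Summable fun n => ∫ x, ‖F n x‖ ∂μ := by
    refine .of_nonneg_of_le (fun n => integral_nonneg fun x => norm_nonneg _) (fun n => ?_)
      (((summable_pnat_rpow hre).mul_left ‖prefactor β w‖).mul_right
        (∫ x in Ioi (0 : ℝ), ‖(x : ℂ) ^ (-q - 1) * S x‖))
    simp only [hF, norm_mul (prefactor β w * M n)]
    rw [integral_const_mul, integral_norm_cpow_mul_comp_mul_left S (-q) (hn n), ← mul_assoc,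
      neg_re, neg_neg, hpow, norm_mul, mul_assoc ‖prefactor β w‖]
    refine mul_le_mul_of_nonneg_right (mul_le_mul_of_nonneg_left ?_ (norm_nonneg _))
      (integral_nonneg fun x => norm_nonneg _)
    refine (mul_le_mul_of_nonneg_right (norm_moebius_div_le n (2 * β)) (by positivity)).trans
      (le_of_eq ?_)
    rw [← Real.rpow_add (hn0 n)]
    congr 1
    simp
    ring
  have hPF (x : ℝ) : HasSum (fun n => F n x) ((x : ℂ) ^ (-q - 1) • P w x β) := by
    have h := ((hasSum_moebius_mul_primTail hβ w x).mul_left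
      ((x : ℂ) ^ (-q - 1) * prefactor β w))
    rw [mul_assoc, prefactor, ← P] at h
    refine h.congr_fun fun n => ?_
    simp only [hF, hM, hS, prefactor]
    push_cast
    rw [← div_eq_inv_mul]
    ring
  refine ⟨integrable_of_summable_integral_norm hFi hsum ?_ hPF, ?_⟩
  · have hc : Measurable fun x : ℝ => P w x β :=
      ((differentiable_P hβ w).continuous.comp continuous_ofReal).measurable
    have hm : Measurable fun x : ℝ => (x : ℂ) ^ (-q - 1) • P w x β := by
      simp only [smul_eq_mul]
      fun_prop
    exact hm.aestronglyMeasurable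
  · have h := hasSum_integral_of_summable_integral_norm hFi hsum
    rw [mellin, integral_congr_ae (.of_forall fun x => (hPF x).tsum_eq.symm), ← h.tsum_eq,
      ← (hasSum_inv_riemannZeta hre).tsum_eq, ← tsum_mul_right, ← tsum_mul_left]
    refine tsum_congr fun n => ?_
    have h4 := mellin_comp_mul_left S (-q) (hn n)
    simp only [mellin, smul_eq_mul] at h4
    simp only [hF]
    rw [integral_const_mul, h4, neg_neg, mul_assoc, ← mul_assoc (M n)]
    simp only [mellin, smul_eq_mul]
    congr 2
    have hnc : ((n : ℕ) : ℂ) ≠ 0 := by exact_mod_cast n.ne_zero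
    rw [hM, cpow_add _ _ hnc, div_mul_eq_div_div, div_eq_mul_inv _ (((n : ℕ) : ℂ) ^ (2 * q))]
    congr 1
    have h5 := inv_cpow_ofReal_nonneg (sq_nonneg ((n : ℕ) : ℝ)) q
    have h6 := natCast_cpow_natCast_mul n 2 q
    push_cast at h5 h6 ⊢
    rw [h5, h6]

/-! ### The integral representations of `f` -/

theorem xi_ne_zero_of_one_lt_re {s : ℂ} (hs : 1 < s.re) : xi s ≠ 0 := by
  have h1 : s ≠ 1 := by
    rintro rfl
    simp at hs
  rw [xi_eq s (by linarith) h1]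
  have hG : Gamma (1 + s / 2) ≠ 0 :=
    Gamma_ne_zero_of_re_pos (by rw [add_re, one_re, div_ofNat_re]; linarith)
  have hp : (Real.pi : ℂ) ^ (-s / 2) ≠ 0 := by simp [cpow_eq_zero_iff, Real.pi_ne_zero]
  have hz : riemannZeta s ≠ 0 := riemannZeta_ne_zero_of_one_lt_re hs
  have h2 : s - 1 ≠ 0 := sub_ne_zero.mpr h1
  exact mul_ne_zero (mul_ne_zero (by norm_num)
    (mul_ne_zero (mul_ne_zero hp (mul_ne_zero two_ne_zero hG)) h2)) hz

theorem sin_pi_mul_div_four_ne_zero {w : ℕ} {s : ℂ} (h1 : 4 * (w : ℝ) < s.re)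
    (h2 : s.re < 4 * ((w : ℝ) + 1)) : sin (Real.pi * s / 4) ≠ 0 := by
  intro h
  obtain ⟨k, hk⟩ := sin_eq_zero_iff.mp h
  have hpi : (Real.pi : ℂ) ≠ 0 := by exact_mod_cast Real.pi_ne_zero
  have hs : s = 4 * k := by
    rw [div_eq_iff (by norm_num)] at hk
    apply mul_left_cancel₀ hpi
    linear_combination hk
  rw [hs] at h1 h2
  simp only [mul_re, re_ofNat, intCast_re, im_ofNat, zero_mul, sub_zero] at h1 h2
  have h3 : (w : ℤ) < k := by exact_mod_cast (by linarith : (w : ℝ) < k)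
  have h4 : k < (w : ℤ) + 1 := by exact_mod_cast (by linarith : (k : ℝ) < w + 1)
  lia

theorem f_eq {s β : ℂ} (hs : 1 < (2 * β + s).re) :
    f s β = (Real.pi : ℂ) ^ (β + s / 2) / (2 * sin (Real.pi * s / 4) * Gamma (1 + β + s / 2) *
      (2 * β + s - 1) * riemannZeta (2 * β + s)) := by
  have h1 : 2 * β + s ≠ 1 := fun h => by rw [h] at hs; simp at hs
  rw [f, xi_eq _ (by linarith) h1, show -(2 * β + s) / 2 = -(β + s / 2) by ring, cpow_neg,
    show 1 + (2 * β + s) / 2 = 1 + β + s / 2 by ring]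
  have hp : (Real.pi : ℂ) ^ (β + s / 2) ≠ 0 := by simp [cpow_eq_zero_iff, Real.pi_ne_zero]
  field_simp

/-- Substituting x = πv^(-2) sends s to -q = -s/2 and yields π^q/2. Together with the prefactor this
completes π^(β+s/2), and (-1)^(w+1) meets the minus sign of `mellin_cosTail`. -/
theorem hasMellin_P_pi_mul_inv_sq {β : ℂ} (hβ : 0 ≤ β.re) (w : ℕ) {s : ℂ}
    (h1 : 4 * (w : ℝ) < s.re) (h2 : s.re < 4 * ((w : ℝ) + 1)) (h3 : 1 - 2 * β.re < s.re) :
    HasMellin (fun v : ℝ => P w ((Real.pi * (v ^ 2)⁻¹ : ℝ) : ℂ) β) s ((-1) ^ w * f s β) := by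
  set q : ℂ := s / 2 with hq
  have hqre : q.re = s.re / 2 := by rw [hq, div_ofNat_re]
  have g1 : 2 * (w : ℝ) < q.re := by rw [hqre]; linarith
  have g2 : q.re < 2 * (w + 1) := by rw [hqre]; linarith
  have g3 : 1 / 2 - β.re < q.re := by rw [hqre]; linarith
  have hre : 1 < (2 * β + s).re := by simp; linarith
  obtain ⟨hPc, hPm⟩ := hasMellin_P hβ w g1 g2 g3
  have hsq : s / ((-2 : ℝ) : ℂ) = -q := by
    rw [hq]
    push_cast
    ring
  have e : EqOn (fun v : ℝ => (v : ℂ) ^ (s - 1) • P w ((Real.pi * v ^ (-2 : ℝ) : ℝ) : ℂ) β)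
      (fun v : ℝ => (v : ℂ) ^ (s - 1) • P w ((Real.pi * (v ^ 2)⁻¹ : ℝ) : ℂ) β) (Ioi 0) := by
    intro v hv
    have hv : 0 < v := hv
    simp only [Real.rpow_neg hv.le, Real.rpow_two]
  constructor
  · have h := (MellinConvergent.comp_rpow (f := fun x : ℝ => P w ((Real.pi * x : ℝ) : ℂ) β) (s := s)
      (by norm_num : (-2 : ℝ) ≠ 0)).mpr
    rw [hsq] at h
    exact (integrableOn_congr_fun e measurableSet_Ioi).mp
      (h ((MellinConvergent.comp_mul_left Real.pi_pos).mpr hPc))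
  · have h := mellin_comp_rpow (fun x : ℝ => P w ((Real.pi * x : ℝ) : ℂ) β) s (-2)
    have h' := mellin_comp_mul_left (fun x : ℝ => P w (x : ℂ) β) (-q) Real.pi_pos
    rw [hsq, h', hPm, (hasMellin_primTail hβ w g1 g2 g3).2, mellin_cosTail hβ w g1 g2, neg_neg] at h
    rw [mellin, ← setIntegral_congr_fun measurableSet_Ioi e]
    refine Eq.trans h ?_
    have hpi : (Real.pi : ℂ) ≠ 0 := by exact_mod_cast Real.pi_ne_zero
    have hsin : sin (Real.pi * s / 4) ≠ 0 := sin_pi_mul_div_four_ne_zero h1 h2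
    have hG := Gamma_one_add_ne_zero hβ
    have hG2 : Gamma (1 + β + q) ≠ 0 := Gamma_ne_zero_of_re_pos (by
      have : (0 : ℝ) ≤ w := w.cast_nonneg
      rw [add_re, add_re, one_re]; linarith)
    have hz : riemannZeta (2 * β + s) ≠ 0 := riemannZeta_ne_zero_of_one_lt_re hre
    have hs1 : 2 * β + s - 1 ≠ 0 := by
      intro h
      rw [sub_eq_zero.mp h] at hre
      simp at hre
    have hs2 : q + β - 1 / 2 = (2 * β + s - 1) / 2 := by rw [hq]; ring
    rw [f_eq hre, ← hq, hs2, show 2 * q = s by rw [hq]; ring,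
      show Real.pi * q / 2 = Real.pi * s / 4 by rw [hq]; ring, prefactor, cpow_sub _ _ hpi,
      cpow_one, cpow_add _ _ hpi, pow_succ]
    have hpβ : (Real.pi : ℂ) ^ β ≠ 0 := by simp [cpow_eq_zero_iff, Real.pi_ne_zero]
    simp only [abs_neg, abs_of_pos (two_pos : (0 : ℝ) < 2), real_smul, smul_eq_mul]
    push_cast
    field_simp

theorem differentiable_xi : Differentiable ℂ xi := by
  have h := differentiable_completedZeta₀
  unfold xi
  fun_prop

theorem analyticOnNhd_f {β : ℂ} (w : ℕ) {a : ℝ} (ha : 4 * (w : ℝ) ≤ a) (h : 1 - 2 * β.re ≤ a) :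
    AnalyticOnNhd ℂ (fun s : ℂ => f s β) {s : ℂ | a < s.re ∧ s.re < 4 * ((w : ℝ) + 1)} := by
  refine DifferentiableOn.analyticOnNhd (fun s hs => ?_)
    ((isOpen_lt continuous_const continuous_re).inter (isOpen_lt continuous_re continuous_const))
  have hx := differentiable_xi
  refine DifferentiableAt.differentiableWithinAt ?_
  unfold f
  refine (differentiableAt_const _).div (by fun_prop) (mul_ne_zero
    (sin_pi_mul_div_four_ne_zero (lt_of_le_of_lt ha hs.1) hs.2)
    (mul_ne_zero two_ne_zero (xi_ne_zero_of_one_lt_re ?_)))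
  have := hs.1
  simp
  linarith

/-- A Mellin transform as a two-sided Laplace transform. -/
theorem laplace_of_hasMellin {F : ℝ → ℂ} {s m : ℂ} (h : HasMellin F s m) :
    Integrable (fun y : ℝ => exp (s * y) * F (Real.exp y)) ∧
      m = ∫ y : ℝ, exp (s * y) * F (Real.exp y) := by
  have hd : ∀ y ∈ (univ : Set ℝ), HasDerivWithinAt Real.exp (Real.exp y) univ y :=
    fun y _ => (Real.hasDerivAt_exp y).hasDerivWithinAt
  have himg : Real.exp '' univ = Ioi 0 := by rw [image_univ, Real.range_exp]
  have e (y : ℝ) : |Real.exp y| • ((Real.exp y : ℂ) ^ (s - 1) • F (Real.exp y)) =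
      exp (s * y) * F (Real.exp y) := by
    have h0 : exp (y : ℂ) ≠ 0 := exp_ne_zero _
    rw [abs_of_pos (Real.exp_pos y), real_smul, smul_eq_mul, ofReal_exp, ← mul_assoc,
      cpow_sub _ _ h0, cpow_one, mul_div_cancel₀ _ h0, cpow_def_of_ne_zero h0, ← ofReal_exp,
      ← ofReal_log (Real.exp_pos y).le, Real.log_exp, mul_comm s]
  have h1 := integrableOn_image_iff_integrableOn_abs_deriv_smul MeasurableSet.univ hd
    Real.exp_injective.injOn (fun t : ℝ => (t : ℂ) ^ (s - 1) • F t)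
  have h2 := integral_image_eq_integral_abs_deriv_smul MeasurableSet.univ hd
    Real.exp_injective.injOn (fun t : ℝ => (t : ℂ) ^ (s - 1) • F t)
  simp only [e, himg, integrableOn_univ, Measure.restrict_univ] at h1 h2
  exact ⟨h1.mp h.1, by rw [← h2, ← h.2, mellin]⟩

theorem laplace_P {β : ℂ} (hβ : 0 ≤ β.re) (w : ℕ) {s : ℂ}
    (h1 : 4 * (w : ℝ) < s.re) (h2 : s.re < 4 * ((w : ℝ) + 1)) (h3 : 1 - 2 * β.re < s.re) :
    Integrable (fun y : ℝ => exp (s * y) * P w ((Real.pi * Real.exp (-2 * y) : ℝ) : ℂ) β) ∧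
    (-1) ^ w * f s β =
      ∫ y : ℝ, exp (s * y) * P w ((Real.pi * Real.exp (-2 * y) : ℝ) : ℂ) β := by
  have h := laplace_of_hasMellin (hasMellin_P_pi_mul_inv_sq hβ w h1 h2 h3)
  have e (y : ℝ) : (Real.exp y ^ 2)⁻¹ = Real.exp (-2 * y) := by
    rw [← Real.exp_nat_mul, ← Real.exp_neg]
    congr 1
    push_cast
    ring
  simpa only [e] using h

/-! ### The coefficients for `β = 1/4` -/

theorem re_one_div_four : ((1 : ℂ) / 4).re = 1 / 4 := by rw [div_ofNat_re, one_re]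

theorem PTerm_one_div_four (z : ℂ) (k : ℕ) :
    PTerm z (1 / 4) k / ((Real.pi : ℂ) ^ (1 - (1 / 4 : ℂ)) * Gamma (1 + 1 / 4)) =
      cTilde k * (-z ^ 2) ^ k := by
  have hG := Gamma_one_add_add_nat (β := 1 / 4) (by rw [re_one_div_four]; norm_num) (2 * k)
  rw [cTilde, PTerm, show (5 / 4 + 2 * (k : ℂ)) = 1 + 1 / 4 + (2 * k : ℕ) by push_cast; ring, hG,
    show 2 * (1 / 4 : ℂ) + 4 * k = 1 / 2 + 4 * k by ring, neg_pow (z ^ 2), ← pow_mul,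
    show 2 * (k : ℂ) + 1 / 4 - 1 / 2 = 2 * k - 1 / 4 by ring,
    show (1 : ℂ) - 1 / 4 = 3 / 4 by norm_num, div_div, div_mul_eq_mul_div, one_mul]
  congr 1
  ring

theorem P_one_div_four_eq_tsum_cTilde (w : ℕ) (z : ℂ) :
    P w z (1 / 4) = (-1) ^ (w + 1) * ∑' j : ℕ, cTilde (j + (w + 1)) * (-z ^ 2) ^ (j + (w + 1)) := by
  simp only [← PTerm_one_div_four]
  rw [tsum_div_const, P]
  ring

theorem P_eq_P_zero_add_sum {β : ℂ} (hβ : 0 ≤ β.re) (w : ℕ) (z : ℂ) :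
    P w z β = (-1) ^ w * (P 0 z β + (((Real.pi : ℂ) ^ (1 - β) * Gamma (1 + β)))⁻¹ *
      ∑ k ∈ Finset.Icc 1 w, PTerm z β k) := by
  have h := (summable_norm_PTerm hβ 0 z).of_norm.sum_add_tsum_nat_add w
  have e : ∑ k ∈ Finset.Icc 1 w, PTerm z β k = ∑ j ∈ Finset.range w, PTerm z β (j + (0 + 1)) := by
    rw [Finset.range_eq_Ico, Finset.sum_Ico_add' (fun k => PTerm z β k) 0 w (0 + 1)]
    rfl
  have e2 : ∑' j : ℕ, PTerm z β (j + w + (0 + 1)) = ∑' j : ℕ, PTerm z β (j + (w + 1)) :=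
    tsum_congr fun j => by rw [zero_add, add_assoc]
  rw [e2, ← e] at h
  rw [P, P, ← h]
  ring

theorem P_one_div_four_eq_P_zero_add (w : ℕ) (z : ℂ) :
    P w z (1 / 4) = (-1) ^ w * (P 0 z (1 / 4) +
      ∑ k ∈ Finset.Icc 1 w, cTilde k * (-z ^ 2) ^ k) := by
  rw [P_eq_P_zero_add_sum (by rw [re_one_div_four]; norm_num) w z]
  simp only [← PTerm_one_div_four]
  rw [← Finset.sum_div, div_eq_inv_mul (∑ k ∈ Finset.Icc 1 w, PTerm z (1 / 4) k)]

theorem P_zero_one_div_four_eq (z : ℂ) :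
    P 0 z (1 / 4) = (4 / ((Real.pi : ℂ) ^ (3 / 4 : ℂ) * Gamma (1 / 4))) *
      (-1 * ∑' j : ℕ, (-z ^ 2) ^ (j + 1) /
        (poch (5 / 4) (2 * (j + 1)) * (2 * ((j + 1 : ℕ) : ℂ) - 1 / 4) *
          riemannZeta (1 / 2 + 4 * ((j + 1 : ℕ) : ℂ)))) := by
  have hG : Gamma (1 + 1 / 4) = 1 / 4 * Gamma (1 / 4) := by
    rw [add_comm, Gamma_add_one _ (by norm_num)]
  have e (j : ℕ) : PTerm z (1 / 4) (j + (0 + 1)) = (-z ^ 2) ^ (j + 1) /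
        (poch (5 / 4) (2 * (j + 1)) * (2 * ((j + 1 : ℕ) : ℂ) - 1 / 4) *
          riemannZeta (1 / 2 + 4 * ((j + 1 : ℕ) : ℂ))) := by
    rw [zero_add, PTerm, show (1 : ℂ) + 1 / 4 = 5 / 4 by norm_num, neg_pow (z ^ 2), ← pow_mul,
      show (2 * (1 / 4 : ℂ) + 4 * ((j + 1 : ℕ) : ℂ)) = 1 / 2 + 4 * ((j + 1 : ℕ) : ℂ) by ring,
      show 2 * ((j + 1 : ℕ) : ℂ) + 1 / 4 - 1 / 2 = 2 * ((j + 1 : ℕ) : ℂ) - 1 / 4 by ring]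
  rw [P, hG, show (1 : ℂ) - 1 / 4 = 3 / 4 by norm_num]
  simp only [e]
  rw [zero_add, pow_one]
  field_simp

/-! ### Partial sums of Dirichlet series with Möbius coefficients -/

/-- The arithmetic function `n ↦ μ(n) n^(-s)`. -/
noncomputable def moebiusPow (s : ℂ) : ArithmeticFunction ℂ :=
  ⟨fun n => ((ArithmeticFunction.moebius n : ℤ) : ℂ) * (n : ℂ) ^ (-s), by simp⟩

/-- The arithmetic function `n ↦ n^(-s)`. -/
noncomputable def zetaPow (s : ℂ) : ArithmeticFunction ℂ :=
  ⟨fun n => if n = 0 then 0 else (n : ℂ) ^ (-s), by simp⟩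

theorem moebiusPow_apply (s : ℂ) (n : ℕ) :
    moebiusPow s n = ((ArithmeticFunction.moebius n : ℤ) : ℂ) * (n : ℂ) ^ (-s) := rfl

theorem zetaPow_apply (s : ℂ) {n : ℕ} (hn : n ≠ 0) : zetaPow s n = (n : ℂ) ^ (-s) := if_neg hn

/-- Complete multiplicativity of n^(-s) pulls k^(-s) out of the convolution, leaving μ * 1. -/
theorem moebiusPow_mul_zetaPow (s : ℂ) : moebiusPow s * zetaPow s = 1 := by
  ext k
  rw [ArithmeticFunction.mul_apply]
  have e : ∀ p ∈ k.divisorsAntidiagonal, moebiusPow s p.1 * zetaPow s p.2 =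
      (k : ℂ) ^ (-s) * (((ArithmeticFunction.moebius : ArithmeticFunction ℂ) p.1) *
        ((ArithmeticFunction.zeta : ArithmeticFunction ℂ) p.2)) := by
    intro p hp
    obtain ⟨h1, h2⟩ := Nat.mem_divisorsAntidiagonal.mp hp
    have hp2 : p.2 ≠ 0 := fun h => h2 (by rw [← h1, h, mul_zero])
    rw [moebiusPow_apply, zetaPow_apply s hp2, ← h1, Nat.cast_mul, natCast_mul_natCast_cpow]
    simp [hp2]
    ring
  rw [Finset.sum_congr rfl e, ← Finset.mul_sum, ← ArithmeticFunction.mul_apply,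
    ArithmeticFunction.coe_moebius_mul_coe_zeta]
  rcases eq_or_ne k 1 with rfl | hk
  · simp
  · simp [ArithmeticFunction.one_apply_ne hk]

theorem sum_moebiusPow_mul_sum_zetaPow (s : ℂ) {N : ℕ} (hN : 1 ≤ N) :
    ∑ n ∈ Finset.Ioc 0 N, moebiusPow s n * ∑ m ∈ Finset.Ioc 0 (N / n), zetaPow s m = 1 := by
  rw [← ArithmeticFunction.sum_Ioc_mul_eq_sum_sum, moebiusPow_mul_zetaPow]
  rw [Finset.sum_eq_single_of_mem 1 (by simp; lia)]
  · simp
  · intro b _ hb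
    exact ArithmeticFunction.one_apply_ne hb

theorem norm_moebiusPow_le (s : ℂ) {n : ℕ} (hn : 0 < n) :
    ‖moebiusPow s n‖ ≤ (n : ℝ) ^ (-s.re) := by
  rw [moebiusPow_apply, norm_mul, norm_natCast_cpow_of_pos hn, neg_re]
  exact mul_le_of_le_one_left (by positivity) (norm_moebius_le_one n)

/-- From ∑ μ(n)⌊N/n⌋ = 1, replacing each floor by N/n costs at most N in all; then (N + 1)/N ≤ 2. -/
theorem norm_sum_moebiusPow_one_le (N : ℕ) :
    ‖∑ n ∈ Finset.Ioc 0 N, moebiusPow 1 n‖ ≤ 2 := by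
  rcases Nat.eq_zero_or_pos N with rfl | hN
  · simp
  have h := sum_moebiusPow_mul_sum_zetaPow 0 hN
  have e : ∀ n ∈ Finset.Ioc 0 N, moebiusPow 0 n * ∑ m ∈ Finset.Ioc 0 (N / n), zetaPow 0 m =
      N * moebiusPow 1 n - ((ArithmeticFunction.moebius n : ℤ) : ℂ) *
        (((N : ℝ) / n - ((N / n : ℕ) : ℝ) : ℝ) : ℂ) := by
    intro n hn
    have hn0 : n ≠ 0 := (Finset.mem_Ioc.mp hn).1.ne'
    have hn1 : (n : ℂ) ≠ 0 := by exact_mod_cast hn0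
    have e1 : ∑ m ∈ Finset.Ioc 0 (N / n), zetaPow 0 m = ((N / n : ℕ) : ℂ) := by
      rw [Finset.sum_congr rfl (g := fun _ => (1 : ℂ)) fun m hm => by
        rw [zetaPow_apply 0 (Finset.mem_Ioc.mp hm).1.ne', neg_zero, cpow_zero]]
      simp
    rw [e1, moebiusPow_apply, moebiusPow_apply, neg_zero, cpow_zero, cpow_neg_one]
    push_cast
    field_simp
    ring
  rw [Finset.sum_congr rfl e, Finset.sum_sub_distrib, ← Finset.mul_sum, sub_eq_iff_eq_add] at h
  have hN' : (0 : ℝ) < N := by exact_mod_cast hN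
  have hb : ‖∑ n ∈ Finset.Ioc 0 N, ((ArithmeticFunction.moebius n : ℤ) : ℂ) *
        (((N : ℝ) / n - ((N / n : ℕ) : ℝ) : ℝ) : ℂ)‖ ≤ N := by
    refine (norm_sum_le_of_le _ (n := fun _ => (1 : ℝ)) fun n hn => ?_).trans (by simp)
    rw [norm_mul, norm_real]
    refine mul_le_one₀ (norm_moebius_le_one n) (norm_nonneg _) ?_
    have h1 : ((N / n : ℕ) : ℝ) ≤ (N : ℝ) / n := Nat.cast_div_le
    have h2 : (N : ℝ) / n < ((N / n : ℕ) : ℝ) + 1 := by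
      rw [← Nat.floor_div_eq_div (K := ℝ)]
      exact Nat.lt_floor_add_one _
    rw [Real.norm_of_nonneg (by linarith)]
    linarith
  have h3 : ‖(N : ℂ) * ∑ n ∈ Finset.Ioc 0 N, moebiusPow 1 n‖ ≤ 1 + N := by
    rw [h]
    exact (norm_add_le _ _).trans (by rw [norm_one]; gcongr)
  rw [norm_mul, norm_natCast] at h3
  have h4 : (1 : ℝ) ≤ N := by exact_mod_cast hN
  have h5 : (N : ℝ) * ‖∑ n ∈ Finset.Ioc 0 N, moebiusPow 1 n‖ ≤ N * 2 := by linarith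
  exact le_of_mul_le_mul_left h5 hN'

/-! ### Partial sums of the zeta series on the line `Re s = 1` -/

theorem summable_inv_nat_add_sq (N : ℕ) : Summable fun i : ℕ => (((i + N + 1 : ℕ) : ℝ) ^ 2)⁻¹ :=
  (summable_nat_add_iff (f := fun n : ℕ => ((n : ℝ) ^ 2)⁻¹) (N + 1)).mpr
    (Real.summable_nat_pow_inv.mpr one_lt_two)

theorem tsum_inv_nat_add_sq_le (N : ℕ) :
    ∑' i : ℕ, (((i + N + 1 : ℕ) : ℝ) ^ 2)⁻¹ ≤ 2 / (N + 1) := by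
  refine Real.tsum_le_of_sum_range_le (fun i => by positivity) fun n => ?_
  have h := sum_Ioo_inv_sq_le (α := ℝ) N (n + N + 1)
  refine le_trans (le_of_eq ?_) h
  have e : Finset.Ioo N (n + N + 1) = Finset.Ico (0 + (N + 1)) (n + (N + 1)) := by
    ext i
    simp
    lia
  rw [e, ← Finset.sum_Ico_add' (fun i : ℕ => ((i : ℝ) ^ 2)⁻¹) 0 n (N + 1), ← Finset.range_eq_Ico]
  rfl

/-- The difference between a term of the zeta series and the corresponding integral. -/
noncomputable def zetaDefect (s : ℂ) (m : ℕ) : ℂ :=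
  (m : ℂ) ^ (-s) - ∫ u in (m : ℝ)..(m + 1 : ℕ), (u : ℂ) ^ (-s)

theorem intervalIntegrable_cpow_of_pos (s : ℂ) {a b : ℝ} (ha : 0 < a) (hb : 0 < b) :
    IntervalIntegrable (fun u : ℝ => (u : ℂ) ^ s) volume a b :=
  intervalIntegral.intervalIntegrable_cpow (Or.inr (notMem_uIcc_of_lt ha hb))

/-- On [m, m + 1] the derivative of u^(-s) is at most |s| m^(-2), because Re s ≥ 1; the mean value
inequality does the rest. -/
theorem norm_zetaDefect_le {s : ℂ} (hs : 1 ≤ s.re) {m : ℕ} (hm : 0 < m) :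
    ‖zetaDefect s m‖ ≤ ‖s‖ * ((m : ℝ) ^ 2)⁻¹ := by
  have hm0 : (0 : ℝ) < m := by exact_mod_cast hm
  have hm1 : (1 : ℝ) ≤ m := by exact_mod_cast hm
  have hle : (m : ℝ) ≤ ((m + 1 : ℕ) : ℝ) := by push_cast; linarith
  have e : zetaDefect s m =
      ∫ u in (m : ℝ)..(m + 1 : ℕ), ((m : ℝ) : ℂ) ^ (-s) - (u : ℂ) ^ (-s) := by
    rw [intervalIntegral.integral_sub (by simp)
      (intervalIntegrable_cpow_of_pos _ hm0 (by positivity)), intervalIntegral.integral_const]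
    simp [zetaDefect]
  rw [e]
  have h := intervalIntegral.norm_integral_le_of_norm_le_const (a := (m : ℝ))
    (b := ((m + 1 : ℕ) : ℝ)) (C := ‖s‖ * ((m : ℝ) ^ 2)⁻¹)
    (f := fun u : ℝ => ((m : ℝ) : ℂ) ^ (-s) - (u : ℂ) ^ (-s)) (fun u hu => ?_)
  · simpa using h
  rw [uIoc_of_le hle] at hu
  have hd : ∀ v ∈ Icc (m : ℝ) u, HasDerivWithinAt (fun t : ℝ => (t : ℂ) ^ (-s))
      (-s * (v : ℂ) ^ (-s - 1)) (Icc (m : ℝ) u) v := fun v hv =>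
    (hasDerivAt_ofReal_cpow (hm0.trans_le hv.1) (-s)).hasDerivWithinAt
  have h2 := Convex.norm_image_sub_le_of_norm_hasDerivWithin_le (C := ‖s‖ * ((m : ℝ) ^ 2)⁻¹)
    hd (fun v hv => ?_) (convex_Icc _ _) (x := u) (y := m) ⟨hu.1.le, le_rfl⟩ ⟨le_rfl, hu.1.le⟩
  · refine h2.trans (mul_le_of_le_one_right (by positivity) ?_)
    have := hu.2
    push_cast at this
    rw [Real.norm_eq_abs, abs_le]
    constructor <;> linarith [hu.1]
  · have hv0 : 0 < v := hm0.trans_le hv.1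
    rw [norm_mul, norm_neg, norm_cpow_eq_rpow_re_of_pos hv0]
    refine mul_le_mul_of_nonneg_left ?_ (norm_nonneg _)
    have h3 : v ^ (-s - 1).re ≤ v ^ (-2 : ℝ) :=
      Real.rpow_le_rpow_of_exponent_le (hm1.trans hv.1) (by simp; linarith)
    refine h3.trans ?_
    rw [Real.rpow_neg hv0.le, Real.rpow_two]
    have := hv.1
    gcongr

theorem summable_zetaDefect {s : ℂ} (hs : 1 ≤ s.re) :
    Summable fun i : ℕ => zetaDefect s (i + 1) :=
  .of_norm_bounded ((summable_inv_nat_add_sq 0).mul_left ‖s‖) fun i =>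
    norm_zetaDefect_le hs (Nat.succ_pos i)

theorem sum_zetaPow_eq (s : ℂ) (N : ℕ) :
    ∑ m ∈ Finset.Ioc 0 N, zetaPow s m = ∑ i ∈ Finset.range N, zetaDefect s (i + 1) +
      ∫ u in (1 : ℝ)..(N + 1 : ℕ), (u : ℂ) ^ (-s) := by
  induction N with
  | zero => simp
  | succ N ih =>
    rw [Finset.sum_Ioc_succ_top (Nat.zero_le N), ih, Finset.sum_range_succ,
      zetaPow_apply s N.succ_ne_zero, zetaDefect,
      ← intervalIntegral.integral_add_adjacent_intervals
        (intervalIntegrable_cpow_of_pos (-s) one_pos (by positivity : (0 : ℝ) < (N + 1 : ℕ)))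
        (intervalIntegrable_cpow_of_pos (-s) (by positivity)
          (by positivity : (0 : ℝ) < (N + 1 + 1 : ℕ)))]
    ring

/-- The tail of the defect series costs 2|s|/y, and moving the endpoint from ⌊y⌋ + 1 to y costs 1/y.
-/
theorem norm_sum_zetaPow_sub_le {s : ℂ} (hs : s.re = 1) {y : ℝ} (hy : 1 ≤ y) :
    ‖∑ m ∈ Finset.Ioc 0 ⌊y⌋₊, zetaPow s m -
      (∑' i : ℕ, zetaDefect s (i + 1) + ∫ u in (1 : ℝ)..y, (u : ℂ) ^ (-s))‖ ≤
      (2 * ‖s‖ + 1) / y := by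
  set N := ⌊y⌋₊
  have hy0 : 0 < y := by linarith
  have hNy : (N : ℝ) ≤ y := Nat.floor_le hy0.le
  have hyN : y < N + 1 := Nat.lt_floor_add_one y
  have h1 := (summable_zetaDefect hs.ge).sum_add_tsum_nat_add N
  have h2 := intervalIntegral.integral_add_adjacent_intervals
    (intervalIntegrable_cpow_of_pos (-s) one_pos hy0)
    (intervalIntegrable_cpow_of_pos (-s) hy0 (by positivity : (0 : ℝ) < (N + 1 : ℕ)))
  rw [sum_zetaPow_eq, ← h1, ← h2, show ∀ a b c d : ℂ, a + (b + c) - (a + d + b) = c - d by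
    intros; ring, add_div]
  refine (norm_sub_le _ _).trans ?_
  rw [add_comm]
  refine add_le_add ?_ ?_
  · refine (tsum_of_norm_bounded ((summable_inv_nat_add_sq N).mul_left ‖s‖).hasSum fun i =>
      norm_zetaDefect_le hs.ge (Nat.succ_pos _)).trans ?_
    rw [tsum_mul_left, mul_comm 2, mul_div_assoc]
    refine mul_le_mul_of_nonneg_left ((tsum_inv_nat_add_sq_le N).trans ?_) (norm_nonneg _)
    gcongr
  · have h := intervalIntegral.norm_integral_le_of_norm_le_const (a := y)
      (b := ((N + 1 : ℕ) : ℝ)) (C := 1 / y) (f := fun u : ℝ => (u : ℂ) ^ (-s)) (fun u hu => ?_)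
    · refine h.trans (mul_le_of_le_one_right (by positivity) ?_)
      push_cast
      rw [abs_le]
      constructor <;> linarith
    · rw [uIoc_of_le (by push_cast; linarith)] at hu
      rw [norm_cpow_eq_rpow_re_of_pos (hy0.trans hu.1), neg_re, hs, Real.rpow_neg_one, one_div]
      have := hu.1.le
      gcongr

theorem integral_cpow_neg_eq {s : ℂ} (hs : s ≠ 1) {y : ℝ} (hy : 0 < y) :
    ∫ u in (1 : ℝ)..y, (u : ℂ) ^ (-s) = ((y : ℂ) ^ (1 - s) - 1) / (1 - s) := by
  rw [integral_cpow (Or.inr ⟨fun h => hs (neg_injective h),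
    notMem_uIcc_of_lt one_pos hy⟩), neg_add_eq_sub, ofReal_one, one_cpow]

theorem tsum_zetaDefect_of_one_lt_re {s : ℂ} (hs : 1 < s.re) :
    ∑' i : ℕ, zetaDefect s (i + 1) = riemannZeta s + 1 / (1 - s) := by
  have hs1 : s ≠ 1 := fun h => by simp [h] at hs
  have h1 := (summable_zetaDefect hs.le).hasSum.tendsto_sum_nat
  have h2 : Tendsto (fun N : ℕ => ∑ m ∈ Finset.Ioc 0 N, zetaPow s m) atTop
      (𝓝 (riemannZeta s)) := by
    have h := LSeriesSummable.LSeriesHasSum (LSeriesSummable_one_iff.mpr hs)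
    rw [LSeries_one_eq_riemannZeta hs] at h
    have h' := (h.tendsto_sum_nat).comp (tendsto_add_atTop_nat 1)
    refine h'.congr fun N => ?_
    rw [Function.comp, Finset.sum_range_succ', LSeries.term_zero, add_zero,
      Finset.range_eq_Ico, Finset.sum_Ico_add' (fun k => LSeries.term 1 s k) 0 N 1]
    refine Finset.sum_congr (by ext; simp; lia) fun m hm => ?_
    have hm0 : m ≠ 0 := (Finset.mem_Ioc.mp hm).1.ne'
    rw [LSeries.term_of_ne_zero hm0, zetaPow_apply s hm0, cpow_neg]
    simp
  have h3 : Tendsto (fun N : ℕ => ∫ u in (1 : ℝ)..(N + 1 : ℕ), (u : ℂ) ^ (-s)) atTop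
      (𝓝 ((0 - 1) / (1 - s))) := by
    have h : Tendsto (fun N : ℕ => ((((N + 1 : ℕ) : ℝ)) : ℂ) ^ (1 - s)) atTop (𝓝 0) := by
      rw [tendsto_zero_iff_norm_tendsto_zero]
      have h0 := ((tendsto_rpow_neg_atTop (y := s.re - 1) (by linarith)).comp
        tendsto_natCast_atTop_atTop).comp (tendsto_add_atTop_nat 1)
      refine h0.congr fun N => ?_
      rw [norm_cpow_eq_rpow_re_of_pos (by positivity)]
      simp
    refine ((h.sub_const 1).div_const (1 - s)).congr fun N => ?_
    rw [integral_cpow_neg_eq hs1 (by positivity)]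
  have h4 := h2.sub h3
  refine tendsto_nhds_unique h1 ?_
  convert! h4.congr fun N => ?_ using 2
  · ring
  · rw [sum_zetaPow_eq]
    ring

theorem continuousAt_zetaDefect {s : ℂ} (hs : s ≠ 1) {m : ℕ} (hm : 0 < m) :
    ContinuousAt (fun s => zetaDefect s m) s := by
  have hm0 : (0 : ℝ) < m := by exact_mod_cast hm
  have e (s : ℂ) (hs : s ≠ 1) : zetaDefect s m = (m : ℂ) ^ (-s) -
      ((((m + 1 : ℕ) : ℂ) ^ (1 - s)) - (m : ℂ) ^ (1 - s)) / (1 - s) := by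
    rw [zetaDefect, integral_cpow (Or.inr ⟨fun h => hs (neg_injective h),
      notMem_uIcc_of_lt hm0 (by positivity : (0 : ℝ) < (m + 1 : ℕ))⟩),
      neg_add_eq_sub]
    simp
  have h1 : (m : ℂ) ≠ 0 := by exact_mod_cast hm.ne'
  have h2 : ((m + 1 : ℕ) : ℂ) ≠ 0 := by exact_mod_cast m.succ_ne_zero
  have h3 : 1 - s ≠ 0 := sub_ne_zero.mpr hs.symm
  have hc : ContinuousAt (fun s : ℂ => (m : ℂ) ^ (-s) -
      ((((m + 1 : ℕ) : ℂ) ^ (1 - s)) - (m : ℂ) ^ (1 - s)) / (1 - s)) s := by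
    refine ContinuousAt.sub ?_ (ContinuousAt.div (ContinuousAt.sub ?_ ?_) (by fun_prop) h3)
    · exact (by fun_prop : ContinuousAt (fun s : ℂ => -s) s).const_cpow (Or.inl h1)
    · exact (by fun_prop : ContinuousAt (fun s : ℂ => 1 - s) s).const_cpow (Or.inl h2)
    · exact (by fun_prop : ContinuousAt (fun s : ℂ => 1 - s) s).const_cpow (Or.inl h1)
  refine hc.congr ?_
  filter_upwards [isOpen_ne.mem_nhds hs] with t ht using (e t ht).symm

/-- Obtained from Re s > 1 by letting s + δ tend to s from the right; (|s| + 1) m^(-2) dominates the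
defects for δ < 1. -/
theorem tsum_zetaDefect_eq {s : ℂ} (hs : s.re = 1) (hs1 : s ≠ 1) :
    ∑' i : ℕ, zetaDefect s (i + 1) = riemannZeta s + 1 / (1 - s) := by
  have hlim : Tendsto (fun δ : ℝ => s + δ) (𝓝[>] 0) (𝓝 s) := by
    have h : Continuous fun δ : ℝ => s + δ := by fun_prop
    have h0 := h.tendsto 0
    simp only [ofReal_zero, add_zero] at h0
    exact h0.mono_left nhdsWithin_le_nhds
  have h1 : Tendsto (fun δ : ℝ => ∑' i : ℕ, zetaDefect (s + δ) (i + 1)) (𝓝[>] 0)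
      (𝓝 (∑' i : ℕ, zetaDefect s (i + 1))) := by
    refine tendsto_tsum_of_dominated_convergence
      ((summable_inv_nat_add_sq 0).mul_left (‖s‖ + 1)) (fun i => ?_) ?_
    · exact (continuousAt_zetaDefect hs1 i.succ_pos).tendsto.comp hlim
    · filter_upwards [self_mem_nhdsWithin, mem_nhdsWithin_of_mem_nhds (Iio_mem_nhds one_pos)]
        with δ hδ hδ1 i
      have hδ : 0 < δ := hδ
      have hδ1 : δ < 1 := hδ1
      refine (norm_zetaDefect_le (s := s + δ) (by simp [hs, hδ.le]) i.succ_pos).trans ?_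
      refine mul_le_mul_of_nonneg_right ((norm_add_le _ _).trans ?_) (by positivity)
      rw [norm_real, Real.norm_of_nonneg hδ.le]
      gcongr
  have h2 : Tendsto (fun δ : ℝ => riemannZeta (s + δ) + 1 / (1 - (s + δ))) (𝓝[>] 0)
      (𝓝 (riemannZeta s + 1 / (1 - s))) := by
    have hc : ContinuousAt (fun t : ℂ => riemannZeta t + 1 / (1 - t)) s :=
      (differentiableAt_riemannZeta hs1).continuousAt.add
        (continuousAt_const.div (by fun_prop) (sub_ne_zero.mpr hs1.symm))
    exact hc.tendsto.comp hlim
  refine tendsto_nhds_unique (h1.congr' ?_) h2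
  filter_upwards [self_mem_nhdsWithin] with δ hδ
  have hδ : 0 < δ := hδ
  exact tsum_zetaDefect_of_one_lt_re (by simp [hs, hδ])

/-! ### Bounded Möbius sums on the line `Re s = 1` -/

/-- In the identity `sum_moebiusPow_mul_sum_zetaPow` the inner sum is replaced by its approximation.
The error at n is at most n^(-1) (2|s| + 1) n/x, and there are at most x terms. -/
theorem exists_norm_sum_moebiusPow_mul_le {s : ℂ} (hs : s.re = 1) :
    ∃ C, ∀ x : ℝ, 1 ≤ x → ‖∑ n ∈ Finset.Ioc 0 ⌊x⌋₊, moebiusPow s n *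
      (∑' i : ℕ, zetaDefect s (i + 1) + ∫ u in (1 : ℝ)..(x / n), (u : ℂ) ^ (-s))‖ ≤ C := by
  refine ⟨1 + (2 * ‖s‖ + 1), fun x hx => ?_⟩
  have hx0 : 0 < x := by linarith
  have h := sum_moebiusPow_mul_sum_zetaPow s (N := ⌊x⌋₊) (Nat.one_le_floor_iff x |>.mpr hx)
  set E : ℕ → ℂ := fun n => ∑ m ∈ Finset.Ioc 0 (⌊x⌋₊ / n), zetaPow s m -
    (∑' i : ℕ, zetaDefect s (i + 1) + ∫ u in (1 : ℝ)..(x / n), (u : ℂ) ^ (-s)) with hE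
  have e : ∑ n ∈ Finset.Ioc 0 ⌊x⌋₊, moebiusPow s n *
      (∑' i : ℕ, zetaDefect s (i + 1) + ∫ u in (1 : ℝ)..(x / n), (u : ℂ) ^ (-s)) =
      1 - ∑ n ∈ Finset.Ioc 0 ⌊x⌋₊, moebiusPow s n * E n := by
    rw [← h, ← Finset.sum_sub_distrib]
    refine Finset.sum_congr rfl fun n _ => ?_
    simp only [hE]
    ring
  rw [e]
  refine (norm_sub_le _ _).trans ?_
  rw [norm_one]
  gcongr
  refine (norm_sum_le_of_le _ (n := fun _ => (2 * ‖s‖ + 1) / x) fun n hn => ?_).trans ?_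
  · obtain ⟨hn0, hnx⟩ := Finset.mem_Ioc.mp hn
    have hn1 : (0 : ℝ) < n := by exact_mod_cast hn0
    have hnx' : (n : ℝ) ≤ x := (Nat.le_floor_iff hx0.le).mp hnx
    have h1 := norm_sum_zetaPow_sub_le hs (y := x / n) ((one_le_div hn1).mpr hnx')
    rw [Nat.floor_div_natCast] at h1
    have h2 := norm_moebiusPow_le s hn0
    rw [hs, Real.rpow_neg_one] at h2
    rw [norm_mul]
    refine (mul_le_mul h2 h1 (norm_nonneg _) (by positivity)).trans (le_of_eq ?_)
    field_simp
  · rw [Finset.sum_const, Nat.card_Ioc, nsmul_eq_mul, Nat.sub_zero, mul_div_assoc', div_le_iff₀ hx0,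
      mul_comm]
    gcongr
    exact Nat.floor_le hx0.le

theorem moebiusPow_mul_div_cpow (s : ℂ) {x : ℝ} (hx : 0 < x) {n : ℕ} (hn : 0 < n) :
    moebiusPow s n * ((x / n : ℝ) : ℂ) ^ (1 - s) = (x : ℂ) ^ (1 - s) * moebiusPow 1 n := by
  have hn1 : (n : ℂ) ≠ 0 := by exact_mod_cast hn.ne'
  have h1 := div_cpow_ofReal_nonneg hx.le n.cast_nonneg (1 - s)
  push_cast at h1 ⊢
  rw [h1, moebiusPow_apply, moebiusPow_apply, show -s = (1 - s) + (-1) by ring, cpow_add _ _ hn1]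
  have h2 : (n : ℂ) ^ (1 - s) ≠ 0 := by simp [cpow_eq_zero_iff, hn1]
  field_simp

/-- For s ≠ 1 the approximating factor is ζ(s) + (x/n)^(1-s)/(1 - s). Its second part collapses to
x^(1-s) ∑ μ(n)/n, which is bounded, and ζ(s) ≠ 0 allows division. -/
theorem exists_norm_sum_moebiusPow_le {s : ℂ} (hs : s.re = 1) :
    ∃ C, ∀ x : ℝ, 1 ≤ x → ‖∑ n ∈ Finset.Ioc 0 ⌊x⌋₊, moebiusPow s n‖ ≤ C := by
  rcases eq_or_ne s 1 with rfl | hs1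
  · exact ⟨2, fun x _ => norm_sum_moebiusPow_one_le _⟩
  obtain ⟨C, hC⟩ := exists_norm_sum_moebiusPow_mul_le hs
  have hz : riemannZeta s ≠ 0 := riemannZeta_ne_zero_of_one_le_re hs.ge
  refine ⟨(C + 2 / ‖1 - s‖) / ‖riemannZeta s‖, fun x hx => ?_⟩
  have hx0 : 0 < x := by linarith
  have e : ∑ n ∈ Finset.Ioc 0 ⌊x⌋₊, moebiusPow s n *
      (∑' i : ℕ, zetaDefect s (i + 1) + ∫ u in (1 : ℝ)..(x / n), (u : ℂ) ^ (-s)) =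
      riemannZeta s * ∑ n ∈ Finset.Ioc 0 ⌊x⌋₊, moebiusPow s n +
        (x : ℂ) ^ (1 - s) / (1 - s) * ∑ n ∈ Finset.Ioc 0 ⌊x⌋₊, moebiusPow 1 n := by
    rw [Finset.mul_sum, Finset.mul_sum, ← Finset.sum_add_distrib]
    refine Finset.sum_congr rfl fun n hn => ?_
    have hn0 := (Finset.mem_Ioc.mp hn).1
    have hn1 : (0 : ℝ) < n := by exact_mod_cast hn0
    rw [tsum_zetaDefect_eq hs hs1, integral_cpow_neg_eq hs1 (div_pos hx0 hn1),
      div_mul_eq_mul_div, ← moebiusPow_mul_div_cpow s hx0 hn0]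
    ring
  have h := hC x hx
  rw [e] at h
  rw [le_div_iff₀ (norm_pos_iff.mpr hz), mul_comm, ← norm_mul]
  have h2 : ‖(x : ℂ) ^ (1 - s) / (1 - s) * ∑ n ∈ Finset.Ioc 0 ⌊x⌋₊, moebiusPow 1 n‖ ≤
      2 / ‖1 - s‖ := by
    rw [norm_mul, norm_div, norm_cpow_eq_rpow_re_of_pos hx0, sub_re, one_re, hs, sub_self,
      Real.rpow_zero, one_div, mul_comm, div_eq_mul_inv]
    gcongr
    exact norm_sum_moebiusPow_one_le _
  have h3 := norm_sub_le (riemannZeta s * ∑ n ∈ Finset.Ioc 0 ⌊x⌋₊, moebiusPow s n +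
        (x : ℂ) ^ (1 - s) / (1 - s) * ∑ n ∈ Finset.Ioc 0 ⌊x⌋₊, moebiusPow 1 n)
        ((x : ℂ) ^ (1 - s) / (1 - s) * ∑ n ∈ Finset.Ioc 0 ⌊x⌋₊, moebiusPow 1 n)
  rw [add_sub_cancel_right] at h3
  linarith

/-- This controls the remainder of `primTail` on the critical line Re β = 1/2, where s = 2β. -/
theorem exists_norm_sum_moebiusPow_mul_integral_le {s : ℂ} (hs : s.re = 1) :
    ∃ C, ∀ x : ℝ, 1 ≤ x → ‖∑ n ∈ Finset.Ioc 0 ⌊x⌋₊, moebiusPow s n *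
      ∫ u in (1 : ℝ)..(x / n), (u : ℂ) ^ (-s)‖ ≤ C := by
  obtain ⟨C, hC⟩ := exists_norm_sum_moebiusPow_mul_le hs
  obtain ⟨D, hD⟩ := exists_norm_sum_moebiusPow_le hs
  refine ⟨C + D * ‖∑' i : ℕ, zetaDefect s (i + 1)‖, fun x hx => ?_⟩
  have h1 := hC x hx
  simp only [mul_add, Finset.sum_add_distrib, ← Finset.sum_mul] at h1
  have h2 : ‖(∑ n ∈ Finset.Ioc 0 ⌊x⌋₊, moebiusPow s n) * ∑' i : ℕ, zetaDefect s (i + 1)‖ ≤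
      D * ‖∑' i : ℕ, zetaDefect s (i + 1)‖ := by
    rw [norm_mul]
    gcongr
    exact hD x hx
  have h3 := norm_sub_le ((∑ n ∈ Finset.Ioc 0 ⌊x⌋₊, moebiusPow s n) *
    ∑' i : ℕ, zetaDefect s (i + 1) + ∑ n ∈ Finset.Ioc 0 ⌊x⌋₊, moebiusPow s n *
      ∫ u in (1 : ℝ)..(x / n), (u : ℂ) ^ (-s))
    ((∑ n ∈ Finset.Ioc 0 ⌊x⌋₊, moebiusPow s n) * ∑' i : ℕ, zetaDefect s (i + 1))
  rw [add_sub_cancel_left] at h3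
  linarith

/-! ### The growth of `primTail β 0` -/

theorem cosTail_zero_eq {β : ℂ} (hβ : 0 ≤ β.re) (z : ℂ) : cosTail β 0 z = cosSeries β z - 1 := by
  simp [cosTail_eq hβ, cosTerm, poch_zero]

theorem exists_norm_cosTail_zero_le {β : ℂ} (hβ : 0 ≤ β.re) :
    ∃ C, 0 ≤ C ∧ ∀ u : ℝ, 0 ≤ u → ‖cosTail β 0 u‖ ≤ C := by
  obtain ⟨C, hC⟩ := exists_norm_cosSeries_le hβ
  have h0 : 0 ≤ C := (norm_nonneg _).trans (hC 0 le_rfl)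
  refine ⟨C + 1, by linarith, fun u hu => ?_⟩
  rw [cosTail_zero_eq hβ]
  refine (norm_sub_le _ _).trans ?_
  rw [norm_one]
  gcongr
  exact hC u hu

/-- For `Re β > 1/2` the function `primTail β 0` is bounded on the positive axis. -/
theorem exists_norm_primTail_le {β : ℂ} (hβ : 1 / 2 < β.re) :
    ∃ C, ∀ y : ℝ, 0 ≤ y → ‖primTail β 0 y‖ ≤ C := by
  have hβ0 : 0 ≤ β.re := by linarith
  obtain ⟨C, hC0, hC⟩ := exists_norm_cosTail_zero_le hβ0
  refine ⟨∫ t in Ioc (0 : ℝ) 1, t ^ (β.re - 3 / 2) * C, fun y hy => ?_⟩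
  rw [primTail_eq_integral hβ0]
  refine norm_integral_le_of_norm_le (Integrable.mul_const ?_ C) ?_
  · exact (intervalIntegrable_iff_integrableOn_Ioc_of_le zero_le_one).mp
      (intervalIntegral.intervalIntegrable_rpow' (by linarith))
  · refine (ae_restrict_mem measurableSet_Ioc).mono fun t ht => ?_
    rw [norm_mul, norm_cpow_eq_rpow_re_of_pos ht.1, ← ofReal_mul]
    have e : (β - 3 / 2).re = β.re - 3 / 2 := by simp
    rw [e]
    exact mul_le_mul_of_nonneg_left (hC _ (mul_nonneg hy ht.1.le))
      (Real.rpow_nonneg ht.1.le _)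

theorem re_sub_three_halves (β : ℂ) : (β - 3 / 2).re = β.re - 3 / 2 := by simp

theorem norm_cpow_mul_cosTail_le {β : ℂ} (hβ : 0 ≤ β.re) {u : ℝ} (hu : u ∈ Ioc (0 : ℝ) 1) :
    ‖(u : ℂ) ^ (β - 3 / 2) * cosTail β 0 u‖ ≤ Real.exp 1 := by
  have e : ‖(u : ℂ)‖ = u := by rw [norm_real, Real.norm_of_nonneg hu.1.le]
  have h := norm_cosTail_le hβ 0 (z := u) (by rw [e]; exact hu.2)
  rw [e] at h
  rw [norm_mul, norm_cpow_eq_rpow_re_of_pos hu.1, re_sub_three_halves]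
  have h1 : u ^ (β.re - 3 / 2) * u ^ (2 * (0 + 1)) ≤ 1 := by
    rw [← Real.rpow_natCast, ← Real.rpow_add hu.1]
    refine Real.rpow_le_one hu.1.le hu.2 ?_
    push_cast
    linarith
  calc u ^ (β.re - 3 / 2) * ‖cosTail β 0 u‖
      ≤ u ^ (β.re - 3 / 2) * (Real.exp 1 * u ^ (2 * (0 + 1))) :=
        mul_le_mul_of_nonneg_left h (Real.rpow_nonneg hu.1.le _)
    _ = Real.exp 1 * (u ^ (β.re - 3 / 2) * u ^ (2 * (0 + 1))) := by ring
    _ ≤ Real.exp 1 * 1 := by gcongr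
    _ = Real.exp 1 := mul_one _

/-- Near the origin `primTail β 0` is of second order. -/
theorem norm_primTail_le {β : ℂ} (hβ : 0 ≤ β.re) {y : ℝ} (hy : 0 ≤ y) (hy1 : y ≤ 1) :
    ‖primTail β 0 y‖ ≤ Real.exp 1 * y ^ 2 := by
  rw [primTail_eq_integral hβ]
  have h := norm_setIntegral_le_of_norm_le_const (s := Ioc (0 : ℝ) 1) (μ := volume)
    (f := fun t : ℝ => (t : ℂ) ^ (β - 3 / 2) * cosTail β 0 (y * t)) (C := Real.exp 1 * y ^ 2)
    (by simp) (fun t ht => ?_)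
  · simpa using h
  have e : ‖(y : ℂ) * t‖ = y * t := by
    rw [← ofReal_mul, norm_real, Real.norm_of_nonneg (mul_nonneg hy ht.1.le)]
  have h := norm_cosTail_le hβ 0 (z := y * t)
    (by rw [e]; exact mul_le_one₀ hy1 ht.1.le ht.2)
  rw [e] at h
  rw [norm_mul, norm_cpow_eq_rpow_re_of_pos ht.1, re_sub_three_halves]
  have h1 : t ^ (β.re - 3 / 2) * t ^ 2 ≤ 1 := by
    rw [← Real.rpow_natCast, ← Real.rpow_add ht.1]
    refine Real.rpow_le_one ht.1.le ht.2 ?_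
    push_cast
    linarith
  calc t ^ (β.re - 3 / 2) * ‖cosTail β 0 (y * t)‖
      ≤ t ^ (β.re - 3 / 2) * (Real.exp 1 * (y * t) ^ (2 * (0 + 1))) :=
        mul_le_mul_of_nonneg_left h (Real.rpow_nonneg ht.1.le _)
    _ = Real.exp 1 * y ^ 2 * (t ^ (β.re - 3 / 2) * t ^ 2) := by ring
    _ ≤ Real.exp 1 * y ^ 2 * 1 := by gcongr
    _ = Real.exp 1 * y ^ 2 := mul_one _

theorem primTail_eq_cpow_mul_integral {β : ℂ} (hβ : 0 ≤ β.re) {y : ℝ} (hy : 0 < y) :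
    primTail β 0 y = (y : ℂ) ^ (1 / 2 - β) *
      ∫ u in (0 : ℝ)..y, (u : ℂ) ^ (β - 3 / 2) * cosTail β 0 u := by
  have hy0 : (y : ℂ) ≠ 0 := by exact_mod_cast hy.ne'
  have h := intervalIntegral.integral_comp_mul_left (a := 0) (b := 1)
    (fun u : ℝ => (u : ℂ) ^ (β - 3 / 2) * cosTail β 0 u) hy.ne'
  rw [mul_zero, mul_one, intervalIntegral.integral_of_le zero_le_one] at h
  have e : ∀ t ∈ Ioc (0 : ℝ) 1, ((y * t : ℝ) : ℂ) ^ (β - 3 / 2) * cosTail β 0 ((y * t : ℝ) : ℂ) =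
      (y : ℂ) ^ (β - 3 / 2) * ((t : ℂ) ^ (β - 3 / 2) * cosTail β 0 (y * t)) := by
    intro t ht
    rw [ofReal_mul, mul_cpow_ofReal_nonneg hy.le ht.1.le, mul_assoc]
  rw [setIntegral_congr_fun measurableSet_Ioc e, integral_const_mul, ← primTail_eq_integral hβ,
    real_smul] at h
  have h2 : (y : ℂ) ^ (β - 3 / 2) * (y : ℂ) ^ (1 / 2 - β) = ((y⁻¹ : ℝ) : ℂ) := by
    rw [← cpow_add _ _ hy0, show β - 3 / 2 + (1 / 2 - β) = -1 by ring, cpow_neg_one, ofReal_inv]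
  have h3 : (y : ℂ) ^ (β - 3 / 2) ≠ 0 := by simp [cpow_eq_zero_iff, hy0]
  apply mul_left_cancel₀ h3
  rw [h, ← mul_assoc, h2]

theorem norm_integral_Ioi_le_of_norm_le_rpow {F : ℝ → ℂ} {C a y : ℝ} (ha : a < -1) (hy : 0 < y)
    (hF : ∀ u, y < u → ‖F u‖ ≤ C * u ^ a) :
    ‖∫ u in Ioi y, F u‖ ≤ C / (-(a + 1)) * y ^ (a + 1) := by
  have h := norm_integral_le_of_norm_le (μ := volume.restrict (Ioi y)) (f := F)
    ((integrableOn_Ioi_rpow_of_lt ha hy).const_mul C)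
    ((ae_restrict_mem measurableSet_Ioi).mono fun u hu => hF u hu)
  refine h.trans (le_of_eq ?_)
  rw [integral_const_mul, integral_Ioi_rpow_of_lt ha hy, neg_div, div_neg]
  ring

/-- For `Re β < 1/2` the function `primTail β 0` is a multiple of `y^(1/2 - β)` up to a bounded
error. -/
theorem exists_norm_primTail_sub_le_of_re_lt {β : ℂ} (hβ : 0 ≤ β.re) (hβ1 : β.re < 1 / 2) :
    ∃ (J : ℂ) (C : ℝ), 0 ≤ C ∧
      ∀ y : ℝ, 1 ≤ y → ‖primTail β 0 y - J * (y : ℂ) ^ (1 / 2 - β)‖ ≤ C := by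
  obtain ⟨C, hC0, hC⟩ := exists_norm_cosTail_zero_le hβ
  have hint : IntegrableOn (fun u : ℝ => (u : ℂ) ^ (β - 3 / 2) * cosTail β 0 u) (Ioi 0) := by
    have h := mellinConvergent_cosTail hβ 0 (q := 1 / 2 - β) (by simpa using hβ1)
      (by simp; linarith)
    rw [MellinConvergent, show -(1 / 2 - β) - 1 = β - 3 / 2 by ring] at h
    exact h
  -- J is the integral over the whole half-line, convergent because Re β < 1/2. The missing part
  -- over (y, ∞) decays like y^(Re β - 1/2), which the prefactor undoes.
  refine ⟨∫ u in Ioi (0 : ℝ), (u : ℂ) ^ (β - 3 / 2) * cosTail β 0 u, C / (1 / 2 - β.re),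
    div_nonneg hC0 (by linarith), fun y hy => ?_⟩
  have hy0 : 0 < y := by linarith
  rw [primTail_eq_cpow_mul_integral hβ hy0, ← intervalIntegral.integral_interval_add_Ioi hint
    (hint.mono_set (Ioi_subset_Ioi hy0.le)), add_mul, mul_comm, sub_add_cancel_left, norm_neg,
    norm_mul, norm_cpow_eq_rpow_re_of_pos hy0]
  have h := norm_integral_Ioi_le_of_norm_le_rpow (C := C) (a := β.re - 3 / 2) (by linarith) hy0
    (F := fun u : ℝ => (u : ℂ) ^ (β - 3 / 2) * cosTail β 0 u) (fun u hu => by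
      have hu0 : 0 < u := hy0.trans hu
      rw [norm_mul, norm_cpow_eq_rpow_re_of_pos hu0, re_sub_three_halves, mul_comm]
      exact mul_le_mul_of_nonneg_right (hC u hu0.le) (Real.rpow_nonneg hu0.le _))
  refine (mul_le_mul_of_nonneg_right h (by positivity)).trans (le_of_eq ?_)
  rw [mul_assoc, ← Real.rpow_add hy0, show β.re - 3 / 2 + 1 + (1 / 2 - β).re = 0 by simp; ring,
    Real.rpow_zero, mul_one]
  congr 1
  ring

theorem sq_cpow_half_sub (β : ℂ) {Y : ℝ} (hY : 0 < Y) :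
    ((Y ^ 2 : ℝ) : ℂ) ^ (1 / 2 - β) = (Y : ℂ) ^ (1 - 2 * β) := by
  have hY0 : (Y : ℂ) ≠ 0 := by exact_mod_cast hY.ne'
  rw [pow_two, ofReal_mul, mul_cpow_ofReal_nonneg hY.le hY.le, ← cpow_add _ _ hY0]
  congr 1
  ring

/-- The substitution u = (Y/v)². It produces the integral occurring in the zeta partial sums at s =
2β; both sides are evaluated explicitly, β = 1/2 being the logarithmic case. -/
theorem sq_cpow_mul_integral (β : ℂ) {Y : ℝ} (hY : 0 < Y) :
    ((Y ^ 2 : ℝ) : ℂ) ^ (1 / 2 - β) * ∫ u in (1 : ℝ)..(Y ^ 2), (u : ℂ) ^ (β - 3 / 2) =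
      2 * ∫ u in (1 : ℝ)..Y, (u : ℂ) ^ (-(2 * β)) := by
  have hY2 : 0 < Y ^ 2 := by positivity
  have hY0 : ((Y ^ 2 : ℝ) : ℂ) ≠ 0 := by exact_mod_cast hY2.ne'
  rcases eq_or_ne β (1 / 2) with rfl | hβ
  · have e (y : ℝ) (hy : 0 < y) : ∫ u in (1 : ℝ)..y, (u : ℂ) ^ (-1 : ℂ) = Real.log y := by
      simp only [cpow_neg_one, ← ofReal_inv]
      rw [intervalIntegral.integral_ofReal, integral_inv_of_pos one_pos hy, div_one]
    rw [show (1 / 2 : ℂ) - 3 / 2 = -1 by norm_num, show -(2 * (1 / 2 : ℂ)) = -1 by norm_num,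
      e _ hY2, e _ hY, sub_self, cpow_zero, one_mul, Real.log_pow]
    push_cast
    rfl
  · have h1 : 3 / 2 - β ≠ 1 := fun h => hβ (by linear_combination -h)
    have h2 : 2 * β ≠ 1 := fun h => hβ (by linear_combination h / 2)
    have h3 : (1 : ℂ) - 2 * β ≠ 0 := sub_ne_zero.mpr h2.symm
    have h4 : β - 1 / 2 ≠ 0 := sub_ne_zero.mpr hβ
    rw [show β - 3 / 2 = -(3 / 2 - β) by ring, integral_cpow_neg_eq h1 hY2,
      integral_cpow_neg_eq h2 hY, ← sq_cpow_half_sub β hY, mul_div_assoc', mul_sub,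
      ← cpow_add _ _ hY0, show 1 / 2 - β + (1 - (3 / 2 - β)) = 0 by ring, cpow_zero,
      show 1 - (3 / 2 - β) = β - 1 / 2 by ring, mul_one]
    rw [mul_div_assoc', div_eq_div_iff h4 h3]
    ring

/-- For `Re β = 1/2` the function `primTail β 0` is described by `y^(1/2 - β)` and an elementary
integral up to a decaying error. -/
theorem exists_norm_primTail_sub_le_of_re_eq {β : ℂ} (hβ : β.re = 1 / 2) :
    ∃ (J : ℂ) (C : ℝ), ∀ Y : ℝ, 1 ≤ Y →
      ‖primTail β 0 ((Y ^ 2 : ℝ) : ℂ) - (J * (Y : ℂ) ^ (1 - 2 * β) -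
        2 * ∫ u in (1 : ℝ)..Y, (u : ℂ) ^ (-(2 * β)))‖ ≤ C / Y := by
  have hβ0 : 0 ≤ β.re := by linarith
  obtain ⟨C, hC⟩ := exists_norm_cosSeries_le_rpow hβ0 (by linarith)
  set g : ℝ → ℂ := fun u => (u : ℂ) ^ (β - 3 / 2) * cosTail β 0 u with hg
  set k : ℝ → ℂ := fun u => (u : ℂ) ^ (β - 3 / 2) * cosSeries β u with hk
  have hkb (u : ℝ) (hu : 1 ≤ u) : ‖k u‖ ≤ C * u ^ (-3 / 2 : ℝ) := by
    have hu0 : 0 < u := by linarith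
    rw [hk, norm_mul, norm_cpow_eq_rpow_re_of_pos hu0, re_sub_three_halves]
    refine (mul_le_mul_of_nonneg_left (hC u hu) (Real.rpow_nonneg hu0.le _)).trans (le_of_eq ?_)
    rw [mul_left_comm, ← Real.rpow_add hu0]
    congr 2
    linarith
  have hcs : Continuous fun u : ℝ => cosSeries β u :=
    (differentiable_cosSeries hβ0).continuous.comp continuous_ofReal
  have hct : Continuous fun u : ℝ => cosTail β 0 u :=
    (differentiable_cosTail hβ0 0).continuous.comp continuous_ofReal
  have hki : IntegrableOn k (Ioi 1) := by
    refine Integrable.mono' ((integrableOn_Ioi_rpow_of_lt (by norm_num : (-3 / 2 : ℝ) < -1)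
      one_pos).const_mul C) ?_ ?_
    · have : Measurable k := by
        have := hcs.measurable
        fun_prop
      exact this.aestronglyMeasurable
    · exact (ae_restrict_mem measurableSet_Ioi).mono fun u hu => hkb u (le_of_lt hu)
  have hg1 : IntervalIntegrable g volume 0 1 := by
    rw [intervalIntegrable_iff_integrableOn_Ioc_of_le zero_le_one]
    refine Measure.integrableOn_of_bounded (M := Real.exp 1) (by simp) ?_ ?_
    · have : Measurable g := by
        have := hct.measurable
        fun_prop
      exact this.aestronglyMeasurable
    · exact (ae_restrict_mem measurableSet_Ioc).mono fun u hu => norm_cpow_mul_cosTail_le hβ0 hu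
  -- For u > 1 write `cosTail` as `cosSeries` - 1. The -1 gives the elementary integral; the rest is
  -- O(u^(-3/2)), so its integral beyond Y² is at most 2C/Y.
  refine ⟨(∫ u in (0 : ℝ)..1, g u) + ∫ u in Ioi (1 : ℝ), k u, 2 * C, fun Y hY => ?_⟩
  have hY0 : 0 < Y := by linarith
  have hY1 : 1 ≤ Y ^ 2 := one_le_pow₀ hY
  have hY2 : 0 < Y ^ 2 := by positivity
  have hc1 := intervalIntegrable_cpow_of_pos (β - 3 / 2) one_pos hY2
  have e1 : ∫ u in (1 : ℝ)..(Y ^ 2), g u = (∫ u in (1 : ℝ)..(Y ^ 2), k u) -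
      ∫ u in (1 : ℝ)..(Y ^ 2), (u : ℂ) ^ (β - 3 / 2) := by
    rw [← intervalIntegral.integral_sub (hc1.mul_continuousOn hcs.continuousOn) hc1]
    refine intervalIntegral.integral_congr fun u _ => ?_
    simp only [hg, cosTail_zero_eq hβ0]
    ring
  have e2 := intervalIntegral.integral_interval_add_Ioi hki (hki.mono_set (Ioi_subset_Ioi hY1))
  have e3 := intervalIntegral.integral_add_adjacent_intervals hg1
    (hc1.mul_continuousOn hct.continuousOn)
  have e4 : primTail β 0 ((Y ^ 2 : ℝ) : ℂ) - (((∫ u in (0 : ℝ)..1, g u) +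
      ∫ u in Ioi (1 : ℝ), k u) * (Y : ℂ) ^ (1 - 2 * β) -
        2 * ∫ u in (1 : ℝ)..Y, (u : ℂ) ^ (-(2 * β))) =
      -((Y : ℂ) ^ (1 - 2 * β) * ∫ u in Ioi (Y ^ 2), k u) := by
    rw [primTail_eq_cpow_mul_integral hβ0 hY2, ← e3, ← sq_cpow_mul_integral β hY0, e1, ← e2,
      sq_cpow_half_sub β hY0]
    ring
  rw [e4, norm_neg, norm_mul, norm_cpow_eq_rpow_re_of_pos hY0]
  have h := norm_integral_Ioi_le_of_norm_le_rpow (F := k) (by norm_num : (-3 / 2 : ℝ) < -1) hY2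
    (fun u hu => hkb u (hY1.trans hu.le))
  have e5 : (1 - 2 * β).re = 0 := by simp [hβ]
  rw [e5, Real.rpow_zero, one_mul]
  refine h.trans (le_of_eq ?_)
  rw [← Real.rpow_natCast, ← Real.rpow_mul hY0.le,
    show ((2 : ℕ) : ℝ) * (-3 / 2 + 1) = -1 by norm_num, Real.rpow_neg_one]
  ring

/-! ### The growth of `P 0` -/

theorem sum_rpow_neg_le {a : ℝ} (ha0 : 0 ≤ a) (ha : a < 1) (N : ℕ) :
    ∑ n ∈ Finset.Ioc 0 N, (n : ℝ) ^ (-a) ≤ (N : ℝ) ^ (1 - a) / (1 - a) := by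
  induction N with
  | zero =>
    rw [Nat.cast_zero, Real.zero_rpow (by linarith)]
    simp
  | succ N ih =>
    rw [Finset.sum_Ioc_succ_top (Nat.zero_le N)]
    refine (add_le_add_left ih _).trans ?_
    have h1 : 0 < 1 - a := by linarith
    have hN : (0 : ℝ) < (N : ℝ) + 1 := by positivity
    -- Bernoulli's inequality for the exponent 1 - a in [0, 1], applied to N/(N + 1) = 1 - 1/(N +
    -- 1).
    have hb := rpow_one_add_le_one_add_mul_self (s := -(1 / ((N : ℝ) + 1))) (p := 1 - a)
      (by rw [neg_le_neg_iff, div_le_one hN]; linarith [N.cast_nonneg (α := ℝ)]) h1.le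
      (by linarith)
    have e : (N : ℝ) ^ (1 - a) = ((N : ℝ) + 1) ^ (1 - a) *
        (1 + -(1 / ((N : ℝ) + 1))) ^ (1 - a) := by
      have h2 : 1 + -(1 / ((N : ℝ) + 1)) = N / (N + 1) := by
        field_simp
        ring
      rw [h2, ← Real.mul_rpow hN.le (by positivity)]
      congr 1
      field_simp
    have e2 : ((N : ℝ) + 1) ^ (1 - a) = ((N : ℝ) + 1) ^ (-a) * (N + 1) := by
      rw [sub_eq_neg_add, Real.rpow_add hN, Real.rpow_one]
    have h3 : (N : ℝ) ^ (1 - a) ≤ ((N : ℝ) + 1) ^ (1 - a) - (1 - a) * ((N : ℝ) + 1) ^ (-a) := by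
      rw [e]
      refine (mul_le_mul_of_nonneg_left hb (by positivity)).trans (le_of_eq ?_)
      rw [e2]
      field_simp
      ring
    push_cast
    rw [le_div_iff₀ h1, add_mul, div_mul_cancel₀ _ h1.ne']
    linarith

theorem P_zero_sq_eq {β : ℂ} (hβ : 0 ≤ β.re) (x : ℝ) (N : ℕ) :
    P 0 ((x ^ 2 : ℝ) : ℂ) β = prefactor β 0 *
      (∑ n ∈ Finset.Ioc 0 N, moebiusPow (2 * β) n * primTail β 0 (((x / n) ^ 2 : ℝ) : ℂ) +
        ∑' i : ℕ, moebiusPow (2 * β) (i + N + 1) *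
          primTail β 0 (((x / (i + N + 1 : ℕ)) ^ 2 : ℝ) : ℂ)) := by
  set a : ℕ → ℂ := fun n => moebiusPow (2 * β) n * primTail β 0 (((x / n) ^ 2 : ℝ) : ℂ) with ha
  have e (n : ℕ+) : ((ArithmeticFunction.moebius (n : ℕ) : ℤ) : ℂ) / ((n : ℕ) : ℂ) ^ (2 * β) *
      primTail β 0 (((x ^ 2 : ℝ) : ℂ) / ((n : ℕ) : ℂ) ^ 2) = a n := by
    simp only [ha, moebiusPow_apply]
    push_cast
    rw [cpow_neg, div_pow, div_eq_mul_inv (((ArithmeticFunction.moebius (n : ℕ) : ℤ) : ℂ))]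
  have hs := (summable_norm_moebius_mul_primTail hβ 0 ((x ^ 2 : ℝ) : ℂ)).of_norm
  simp only [e] at hs
  rw [summable_pnat_iff_summable_succ] at hs
  have h := hs.sum_add_tsum_nat_add N
  have e2 : ∑ i ∈ Finset.range N, a (i + 1) = ∑ n ∈ Finset.Ioc 0 N, a n := by
    rw [Finset.range_eq_Ico, Finset.sum_Ico_add' a 0 N 1]
    exact Finset.sum_congr (by ext; simp; lia) fun _ _ => rfl
  rw [P_eq_tsum_primTail hβ]
  simp only [e]
  rw [tsum_pnat_eq_tsum_succ, ← h, e2]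

/-- For n > x the argument y = (x/n)² is at most 1, so the quadratic bound gives e·y² ≤ e·y, which
is summable in n. -/
theorem norm_tsum_moebiusPow_mul_primTail_le {β : ℂ} (hβ : 0 ≤ β.re) {x : ℝ} (hx : 1 ≤ x) :
    ‖∑' i : ℕ, moebiusPow (2 * β) (i + ⌊x⌋₊ + 1) *
      primTail β 0 (((x / (i + ⌊x⌋₊ + 1 : ℕ)) ^ 2 : ℝ) : ℂ)‖ ≤
      2 * Real.exp 1 * x ^ (1 - 2 * β.re) := by
  have hx0 : 0 < x := by linarith
  have hxN : x < ⌊x⌋₊ + 1 := Nat.lt_floor_add_one x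
  refine (tsum_of_norm_bounded ((summable_inv_nat_add_sq ⌊x⌋₊).mul_left
    (x ^ (-(2 * β.re)) * (Real.exp 1 * x ^ 2))).hasSum fun i => ?_).trans ?_
  · set n : ℕ := i + ⌊x⌋₊ + 1 with hn
    have hn0 : 0 < n := Nat.succ_pos _
    have hn1 : (0 : ℝ) < n := by exact_mod_cast hn0
    have hxn : x ≤ n := by
      rw [hn]
      push_cast
      linarith [i.cast_nonneg (α := ℝ)]
    have h1 := norm_moebiusPow_le (2 * β) hn0
    have e : (2 * β).re = 2 * β.re := by simp
    rw [e] at h1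
    have h2 : (n : ℝ) ^ (-(2 * β.re)) ≤ x ^ (-(2 * β.re)) :=
      Real.rpow_le_rpow_of_nonpos hx0 hxn (by linarith)
    have h3 : x / n ≤ 1 := (div_le_one hn1).mpr hxn
    have h4 : 0 ≤ x / n := by positivity
    have h5 : (x / n) ^ 2 ≤ 1 := pow_le_one₀ h4 h3
    have h6 := norm_primTail_le hβ (y := (x / n) ^ 2) (by positivity) h5
    have h7 : ((x / n) ^ 2) ^ 2 ≤ (x / n) ^ 2 := by
      rw [pow_two ((x / n) ^ 2)]
      exact mul_le_of_le_one_left (by positivity) h5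
    rw [norm_mul, mul_assoc]
    refine mul_le_mul (h1.trans h2) (h6.trans ?_) (norm_nonneg _) (by positivity)
    rw [mul_assoc, ← div_eq_mul_inv, ← div_pow]
    gcongr
  · rw [tsum_mul_left]
    have h1 : ∑' i : ℕ, (((i + ⌊x⌋₊ + 1 : ℕ) : ℝ) ^ 2)⁻¹ ≤ 2 / x :=
      (tsum_inv_nat_add_sq_le _).trans (by gcongr)
    refine (mul_le_mul_of_nonneg_left h1 (by positivity)).trans (le_of_eq ?_)
    rw [sub_eq_neg_add, Real.rpow_add hx0, Real.rpow_one]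
    field_simp

/-- The two cases differ only in the remainder: for Re β < 1/2 it is summed in absolute value, while
on Re β = 1/2 its integral part needs Möbius cancellation and only the O(n/x) part is summed
trivially. -/
theorem exists_norm_sum_moebiusPow_mul_primTail_le {β : ℂ} (hβ : 0 ≤ β.re) (hβ1 : β.re ≤ 1 / 2) :
    ∃ C, ∀ x : ℝ, 1 ≤ x → ‖∑ n ∈ Finset.Ioc 0 ⌊x⌋₊, moebiusPow (2 * β) n *
      primTail β 0 (((x / n) ^ 2 : ℝ) : ℂ)‖ ≤ C * x ^ (1 - 2 * β.re) := by
  have hre : (1 - 2 * β).re = 1 - 2 * β.re := by simp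
  have hre2 : (2 * β).re = 2 * β.re := by simp
  have hmain (J : ℂ) {x : ℝ} (hx : 0 < x) : ‖∑ n ∈ Finset.Ioc 0 ⌊x⌋₊, moebiusPow (2 * β) n *
      (J * ((x / n : ℝ) : ℂ) ^ (1 - 2 * β))‖ ≤ 2 * ‖J‖ * x ^ (1 - 2 * β.re) := by
    have e : ∑ n ∈ Finset.Ioc 0 ⌊x⌋₊, moebiusPow (2 * β) n *
        (J * ((x / n : ℝ) : ℂ) ^ (1 - 2 * β)) = J * (x : ℂ) ^ (1 - 2 * β) *
          ∑ n ∈ Finset.Ioc 0 ⌊x⌋₊, moebiusPow 1 n := by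
      rw [Finset.mul_sum]
      refine Finset.sum_congr rfl fun n hn => ?_
      rw [mul_left_comm, moebiusPow_mul_div_cpow _ hx (Finset.mem_Ioc.mp hn).1, mul_assoc]
    rw [e, norm_mul, norm_mul, norm_cpow_eq_rpow_re_of_pos hx, hre, mul_comm, mul_assoc]
    exact mul_le_mul_of_nonneg_right (norm_sum_moebiusPow_one_le _) (by positivity)
  rcases hβ1.lt_or_eq with h | h
  · obtain ⟨J, C, hC0, hC⟩ := exists_norm_primTail_sub_le_of_re_lt hβ h
    refine ⟨2 * ‖J‖ + C / (1 - 2 * β.re), fun x hx => ?_⟩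
    have hx0 : 0 < x := by linarith
    have hsplit : ∑ n ∈ Finset.Ioc 0 ⌊x⌋₊, moebiusPow (2 * β) n *
        primTail β 0 (((x / n) ^ 2 : ℝ) : ℂ) =
        ∑ n ∈ Finset.Ioc 0 ⌊x⌋₊, moebiusPow (2 * β) n * (J * ((x / n : ℝ) : ℂ) ^ (1 - 2 * β)) +
        ∑ n ∈ Finset.Ioc 0 ⌊x⌋₊, moebiusPow (2 * β) n *
          (primTail β 0 (((x / n) ^ 2 : ℝ) : ℂ) - J * ((x / n : ℝ) : ℂ) ^ (1 - 2 * β)) := by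
      rw [← Finset.sum_add_distrib]
      exact Finset.sum_congr rfl fun n _ => by ring
    rw [hsplit, add_mul]
    refine (norm_add_le _ _).trans (add_le_add (hmain J hx0) ?_)
    refine (norm_sum_le_of_le _ (n := fun n : ℕ => (n : ℝ) ^ (-(2 * β.re)) * C)
      fun n hn => ?_).trans ?_
    · obtain ⟨hn0, hnx⟩ := Finset.mem_Ioc.mp hn
      have hn1 : (0 : ℝ) < n := by exact_mod_cast hn0
      have hnx' : 1 ≤ x / n := (one_le_div hn1).mpr ((Nat.le_floor_iff hx0.le).mp hnx)
      have h1 := norm_moebiusPow_le (2 * β) hn0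
      rw [hre2] at h1
      have h2 := hC ((x / n) ^ 2) (one_le_pow₀ hnx')
      rw [sq_cpow_half_sub β (by positivity)] at h2
      rw [norm_mul]
      exact mul_le_mul h1 h2 (norm_nonneg _) (by positivity)
    · rw [← Finset.sum_mul, mul_comm, div_mul_eq_mul_div, mul_div_assoc]
      refine mul_le_mul_of_nonneg_left ((sum_rpow_neg_le (by linarith) (by linarith) _).trans ?_) hC0
      have h1 : 0 < 1 - 2 * β.re := by linarith
      gcongr
      exact Nat.floor_le hx0.le
  · obtain ⟨J, C, hC⟩ := exists_norm_primTail_sub_le_of_re_eq h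
    obtain ⟨D, hD⟩ := exists_norm_sum_moebiusPow_mul_integral_le (s := 2 * β)
      (by rw [hre2, h]; norm_num)
    refine ⟨2 * ‖J‖ + (2 * D + |C|), fun x hx => ?_⟩
    have hx0 : 0 < x := by linarith
    have hsplit : ∑ n ∈ Finset.Ioc 0 ⌊x⌋₊, moebiusPow (2 * β) n *
        primTail β 0 (((x / n) ^ 2 : ℝ) : ℂ) =
        ∑ n ∈ Finset.Ioc 0 ⌊x⌋₊, moebiusPow (2 * β) n * (J * ((x / n : ℝ) : ℂ) ^ (1 - 2 * β)) +
        (-2 * (∑ n ∈ Finset.Ioc 0 ⌊x⌋₊, moebiusPow (2 * β) n *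
          ∫ u in (1 : ℝ)..(x / n), (u : ℂ) ^ (-(2 * β))) +
        ∑ n ∈ Finset.Ioc 0 ⌊x⌋₊, moebiusPow (2 * β) n * (primTail β 0 (((x / n) ^ 2 : ℝ) : ℂ) -
          (J * ((x / n : ℝ) : ℂ) ^ (1 - 2 * β) -
            2 * ∫ u in (1 : ℝ)..(x / n), (u : ℂ) ^ (-(2 * β))))) := by
      rw [Finset.mul_sum, ← Finset.sum_add_distrib, ← Finset.sum_add_distrib]
      exact Finset.sum_congr rfl fun n _ => by ring
    rw [hsplit, add_mul]
    refine (norm_add_le _ _).trans (add_le_add (hmain J hx0) ?_)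
    rw [h, show (1 : ℝ) - 2 * (1 / 2) = 0 by norm_num, Real.rpow_zero, mul_one]
    refine (norm_add_le _ _).trans (add_le_add ?_ ?_)
    · rw [norm_mul, norm_neg, norm_ofNat]
      gcongr
      exact hD x hx
    · refine (norm_sum_le_of_le _ (n := fun _ : ℕ => |C| / x) fun n hn => ?_).trans ?_
      · obtain ⟨hn0, hnx⟩ := Finset.mem_Ioc.mp hn
        have hn1 : (0 : ℝ) < n := by exact_mod_cast hn0
        have hnx' : 1 ≤ x / n := (one_le_div hn1).mpr ((Nat.le_floor_iff hx0.le).mp hnx)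
        have h1 := norm_moebiusPow_le (2 * β) hn0
        rw [hre2, h, show -(2 * (1 / 2) : ℝ) = -1 by norm_num, Real.rpow_neg_one] at h1
        have h2 : _ ≤ |C| / (x / n) :=
          (hC (x / n) hnx').trans (div_le_div_of_nonneg_right (le_abs_self C) (by positivity))
        rw [norm_mul]
        refine (mul_le_mul h1 h2 (norm_nonneg _) (by positivity)).trans (le_of_eq ?_)
        field_simp
      · rw [Finset.sum_const, Nat.card_Ioc, nsmul_eq_mul, Nat.sub_zero, mul_div_assoc',
          div_le_iff₀ hx0, mul_comm]
        gcongr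
        exact Nat.floor_le hx0.le

theorem P_zero_isBigO {β : ℂ} (hβ : 0 ≤ β.re) :
    (fun r : ℝ => P 0 (r : ℂ) β) =O[atTop]
      (fun r : ℝ => r ^ (max 0 (1 - 2 * β.re) / 2)) := by
  rcases lt_or_ge (1 / 2) β.re with h | h
  · rw [max_eq_left (by linarith), zero_div]
    simp only [Real.rpow_zero]
    obtain ⟨C, hC⟩ := exists_norm_primTail_le h
    refine .of_bound (‖prefactor β 0‖ * ∑' n : ℕ+, ((n : ℕ) : ℝ) ^ (-(2 * β.re)) * C) ?_
    filter_upwards [eventually_ge_atTop 0] with r hr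
    rw [norm_one, mul_one, P_eq_tsum_primTail hβ, norm_mul]
    refine mul_le_mul_of_nonneg_left ?_ (norm_nonneg _)
    refine tsum_of_norm_bounded
      ((summable_pnat_rpow (by linarith : 1 < 2 * β.re)).mul_right C).hasSum fun n => ?_
    have h1 := norm_moebius_div_le n (2 * β)
    have e : (2 * β).re = 2 * β.re := by simp
    rw [e] at h1
    have h2 := hC (r / ((n : ℕ) : ℝ) ^ 2) (by positivity)
    push_cast at h2
    rw [norm_mul]
    exact mul_le_mul h1 h2 (norm_nonneg _) (by positivity)
  · rw [max_eq_right (by linarith)]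
    obtain ⟨C, hC⟩ := exists_norm_sum_moebiusPow_mul_primTail_le hβ h
    refine .of_bound (‖prefactor β 0‖ * (C + 2 * Real.exp 1)) ?_
    filter_upwards [eventually_ge_atTop 1] with r hr
    set x := Real.sqrt r with hx
    have hx1 : 1 ≤ x := Real.one_le_sqrt.mpr hr
    have hx0 : 0 < x := by linarith
    have hr2 : r = x ^ 2 := (Real.sq_sqrt (by linarith)).symm
    have e : r ^ ((1 - 2 * β.re) / 2) = x ^ (1 - 2 * β.re) := by
      rw [hr2, ← Real.rpow_natCast, ← Real.rpow_mul hx0.le]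
      congr 1
      push_cast
      ring
    rw [e, Real.norm_of_nonneg (by positivity), hr2, P_zero_sq_eq hβ x ⌊x⌋₊, norm_mul, mul_assoc]
    refine mul_le_mul_of_nonneg_left ?_ (norm_nonneg _)
    rw [add_mul]
    exact (norm_add_le _ _).trans
      (add_le_add (hC x hx1) (norm_tsum_moebiusPow_mul_primTail_le hβ hx1))

/-- Up to sign, P_{4w} is P_0 plus a polynomial of degree at most 2w, and P_0 grows with exponent at
most 1/2. -/
theorem P_isBigO {β : ℂ} (hβ : 0 ≤ β.re) {w : ℕ} (hw : 1 ≤ w) :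
    (fun r : ℝ => P w (r : ℂ) β) =O[atTop] (fun r : ℝ => r ^ (2 * w)) := by
  simp only [P_eq_P_zero_add_sum hβ w]
  refine .const_mul_left (.add ((P_zero_isBigO hβ).trans ?_)
    (.const_mul_left (.fun_sum fun k hk => ?_) _)) _
  · refine .of_bound 1 ?_
    filter_upwards [eventually_ge_atTop 1] with r hr
    rw [one_mul, Real.norm_of_nonneg (by positivity), Real.norm_of_nonneg (by positivity),
      ← Real.rpow_natCast]
    refine Real.rpow_le_rpow_of_exponent_le hr ?_
    have : (1 : ℝ) ≤ w := by exact_mod_cast hw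
    push_cast
    have h2 : max 0 (1 - 2 * β.re) ≤ 1 := max_le zero_le_one (by linarith)
    linarith
  · have hk' := Finset.mem_Icc.mp hk
    refine .of_bound (∑' n : ℕ+, ((n : ℕ) : ℝ) ^ (-2 : ℝ)) ?_
    filter_upwards [eventually_ge_atTop 1] with r hr
    refine (norm_PTerm_le hβ r hk'.1).trans ?_
    rw [mul_comm, norm_real, Real.norm_of_nonneg (by linarith : 0 ≤ r),
      Real.norm_of_nonneg (by positivity)]
    refine mul_le_mul_of_nonneg_left ?_ (tsum_nonneg fun n => by positivity)
    refine (div_le_self (by positivity) (by exact_mod_cast Nat.factorial_pos _)).trans ?_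
    exact pow_le_pow_right₀ hr (by lia)

end XiMellin

theorem mainTheorem1 :
    -- general `β` with `Re β ≥ 0`
    (∀ β : ℂ, 0 ≤ β.re →
      -- absolute convergence of the series defining `P_{4w}` and `T_0`; `P_{4w}` is entire in `z`
      (∀ (w : ℕ) (z : ℂ),
        Summable (fun j : ℕ => ‖XiMellin.PTerm z β (j + (w + 1))‖) ∧
        Summable (fun j : ℕ => ‖XiMellin.TTerm z β (j + (w + 1))‖)) ∧
      (∀ w : ℕ, Differentiable ℂ (fun z : ℂ => XiMellin.P w z β)) ∧
      -- (1)
      (∀ s : ℂ, max 0 (1 - 2 * β.re) < s.re → s.re < 4 →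
        MeasureTheory.IntegrableOn
          (fun v : ℝ => (v : ℂ) ^ (s - 1) * XiMellin.P 0 ((Real.pi * (v ^ 2)⁻¹ : ℝ) : ℂ) β)
          (Set.Ioi 0) ∧
        XiMellin.f s β =
          ∫ v in Set.Ioi (0 : ℝ),
            (v : ℂ) ^ (s - 1) * XiMellin.P 0 ((Real.pi * (v ^ 2)⁻¹ : ℝ) : ℂ) β) ∧
      -- (2)
      (∀ w : ℕ, 1 ≤ w → ∀ s : ℂ, 4 * (w : ℝ) < s.re → s.re < 4 * ((w : ℝ) + 1) →
        MeasureTheory.IntegrableOn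
          (fun v : ℝ => (v : ℂ) ^ (s - 1) * XiMellin.P w ((Real.pi * (v ^ 2)⁻¹ : ℝ) : ℂ) β)
          (Set.Ioi 0) ∧
        (-1) ^ w * XiMellin.f s β =
          ∫ v in Set.Ioi (0 : ℝ),
            (v : ℂ) ^ (s - 1) * XiMellin.P w ((Real.pi * (v ^ 2)⁻¹ : ℝ) : ℂ) β) ∧
      -- (3), the sum over `n ≥ 1`, absolutely convergent
      (∀ (w : ℕ) (z : ℂ),
        Summable (fun n : ℕ+ =>
          ‖((ArithmeticFunction.moebius (n : ℕ) : ℤ) : ℂ) / ((n : ℕ) : ℂ) ^ (2 * β) *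
            XiMellin.T0 (Complex.I * z / ((n : ℕ) : ℂ) ^ 2) β w‖) ∧
        XiMellin.P w (Real.pi * z) β =
          ∑' n : ℕ+, ((ArithmeticFunction.moebius (n : ℕ) : ℤ) : ℂ) / ((n : ℕ) : ℂ) ^ (2 * β) *
            XiMellin.T0 (Complex.I * z / ((n : ℕ) : ℂ) ^ 2) β w) ∧
      -- (4)
      ((fun r : ℝ => XiMellin.P 0 (r : ℂ) β) =O[Filter.atTop]
        (fun r : ℝ => r ^ (max 0 (1 - 2 * β.re) / 2))) ∧
      (∀ w : ℕ, 1 ≤ w →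
        (fun r : ℝ => XiMellin.P w (r : ℂ) β) =O[Filter.atTop] (fun r : ℝ => r ^ (2 * w)))) ∧
    -- `β = 1/4`: the two-sided Laplace transform on `1/2 < Re s < 4`
    AnalyticOnNhd ℂ (fun s : ℂ => XiMellin.f s (1 / 4)) {s : ℂ | 1 / 2 < s.re ∧ s.re < 4} ∧
    (∀ s : ℂ, 1 / 2 < s.re → s.re < 4 →
      MeasureTheory.Integrable
        (fun y : ℝ => Complex.exp (s * y) *
          XiMellin.P 0 ((Real.pi * Real.exp (-2 * y) : ℝ) : ℂ) (1 / 4)) ∧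
      XiMellin.f s (1 / 4) =
        ∫ y : ℝ, Complex.exp (s * y) *
          XiMellin.P 0 ((Real.pi * Real.exp (-2 * y) : ℝ) : ℂ) (1 / 4)) ∧
    (∀ z : ℂ,
      XiMellin.P 0 z (1 / 4) =
          (4 / ((Real.pi : ℂ) ^ (3 / 4 : ℂ) * Complex.Gamma (1 / 4))) *
            (-1 * ∑' j : ℕ, (-z ^ 2) ^ (j + 1) /
              (XiMellin.poch (5 / 4) (2 * (j + 1)) * (2 * ((j + 1 : ℕ) : ℂ) - 1 / 4) *
                riemannZeta (1 / 2 + 4 * ((j + 1 : ℕ) : ℂ)))) ∧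
      XiMellin.P 0 z (1 / 4) = -1 * ∑' j : ℕ, XiMellin.cTilde (j + 1) * (-z ^ 2) ^ (j + 1)) ∧
    -- `β = 1/4`: the strips `4w < Re s < 4w + 4` with `w ≥ 1`
    (∀ w : ℕ, 1 ≤ w →
      AnalyticOnNhd ℂ (fun s : ℂ => XiMellin.f s (1 / 4))
        {s : ℂ | 4 * (w : ℝ) < s.re ∧ s.re < 4 * ((w : ℝ) + 1)} ∧
      (∀ s : ℂ, 4 * (w : ℝ) < s.re → s.re < 4 * ((w : ℝ) + 1) →
        MeasureTheory.Integrable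
          (fun y : ℝ => Complex.exp (s * y) *
            XiMellin.P w ((Real.pi * Real.exp (-2 * y) : ℝ) : ℂ) (1 / 4)) ∧
        (-1) ^ w * XiMellin.f s (1 / 4) =
          ∫ y : ℝ, Complex.exp (s * y) *
            XiMellin.P w ((Real.pi * Real.exp (-2 * y) : ℝ) : ℂ) (1 / 4)) ∧
      (∀ z : ℂ,
        XiMellin.P w z (1 / 4) =
          (-1) ^ w * (XiMellin.P 0 z (1 / 4) +
            ∑ k ∈ Finset.Icc 1 w, XiMellin.cTilde k * (-z ^ 2) ^ k) ∧
        XiMellin.P w z (1 / 4) =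
          (-1) ^ (w + 1) *
            ∑' j : ℕ, XiMellin.cTilde (j + (w + 1)) * (-z ^ 2) ^ (j + (w + 1)))) ∧
    -- `β = 1/4`: the growth of `P_0`
    (∀ ε : ℝ, 0 < ε →
      (fun v : ℝ => XiMellin.P 0 (v : ℂ) (1 / 4)) =O[Filter.atTop]
        (fun v : ℝ => v ^ (1 / 4 + ε))) := by
  have hq : (0 : ℝ) ≤ ((1 : ℂ) / 4).re := by rw [XiMellin.re_one_div_four]; norm_num
  have hq2 : 1 - 2 * ((1 : ℂ) / 4).re = 1 / 2 := by rw [XiMellin.re_one_div_four]; norm_num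
  refine ⟨fun β hβ => ⟨fun w z => ⟨XiMellin.summable_norm_PTerm hβ w z,
    XiMellin.summable_norm_TTerm hβ w z⟩, XiMellin.differentiable_P hβ, fun s h1 h2 => ?_,
    fun w hw s h1 h2 => ?_, XiMellin.P_eq_tsum_T0 hβ, XiMellin.P_zero_isBigO hβ,
    fun w hw => XiMellin.P_isBigO hβ hw⟩, ?_, fun s h1 h2 => ?_, fun z => ⟨?_, ?_⟩,
    fun w hw => ⟨?_, fun s h1 h2 => ?_, fun z => ⟨?_, ?_⟩⟩, fun ε hε => ?_⟩
  · obtain ⟨h3, h4⟩ := max_lt_iff.mp h1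
    have h := XiMellin.hasMellin_P_pi_mul_inv_sq hβ 0 (s := s) (by simpa using h3)
      (by simpa using h2) h4
    rw [pow_zero, one_mul] at h
    exact ⟨h.1, h.2.symm⟩
  · have hw1 : (1 : ℝ) ≤ w := by exact_mod_cast hw
    have h := XiMellin.hasMellin_P_pi_mul_inv_sq hβ w h1 h2 (by linarith)
    exact ⟨h.1, h.2.symm⟩
  · have h := XiMellin.analyticOnNhd_f (β := 1 / 4) 0 (a := 1 / 2) (by norm_num) hq2.le
    simpa using h
  · have h := XiMellin.laplace_P hq 0 (s := s) (by simp; linarith) (by simpa using h2)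
      (by rw [hq2]; exact h1)
    rwa [pow_zero, one_mul] at h
  · exact XiMellin.P_zero_one_div_four_eq z
  · simpa using XiMellin.P_one_div_four_eq_tsum_cTilde 0 z
  · have hw1 : (1 : ℝ) ≤ w := by exact_mod_cast hw
    exact XiMellin.analyticOnNhd_f w le_rfl (by rw [hq2]; linarith)
  · have hw1 : (1 : ℝ) ≤ w := by exact_mod_cast hw
    exact XiMellin.laplace_P hq w h1 h2 (by rw [hq2]; linarith)
  · exact XiMellin.P_one_div_four_eq_P_zero_add w z
  · exact XiMellin.P_one_div_four_eq_tsum_cTilde w z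
  -- At β = 1/4 the general bound already has exponent exactly 1/4, so ε is pure slack.
  · refine (XiMellin.P_zero_isBigO hq).trans (.of_bound 1 ?_)
    filter_upwards [Filter.eventually_ge_atTop 1] with r hr
    rw [hq2, max_eq_right (by norm_num), one_mul, Real.norm_of_nonneg (by positivity),
      Real.norm_of_nonneg (by positivity)]
    exact Real.rpow_le_rpow_of_exponent_le hr (by linarith)
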